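/- Let $G$ be a finite group and let $\Sigma=(V,E,F)$ be a connected two-dimensional CW complex with finite sets of vertices $V$ and of oriented edges $E$, each of whose faces $f\in F$ is glued along a closed edge path $\partial f=q_1^{a_1}\cdots q_k^{a_k}$ ($q_i\in E$, $a_i=\pm1$). Let $Y=\{y_1,\dots,y_R\}\subseteq V$ be a nonempty set of ghost vertices, and let a subgroup $H_i\le G$ be associated with each $y_i$. On $\mathbb C[G^E]$, with basis $|g\rangle$, $g\in G^E$, let $X_v^h$ multiply $g_e$ on the left by $h$ for each edge $e$ leaving $v$ and on the right by $h^{-1}$ for each edge $e$ entering $v$. Let $\mathcal C\subseteq\mathbb C[G^E]$ be the joint $+1$-eigenspace of the checks $X_v^h$ ($v\in V\setminus Y$, $h\in G$), the checks $X_{y_i}^h$ ($1\le i\le R$, $h\in H_i$), and the projectors $Z_f:|g\rangle\mapsto\mathbb I(g_{q_1}^{a_1}\cdots g_{q_k}^{a_k}=1)\,|g\rangle$ ($f\in F$). Let $\Sigma/Y$ be $\Sigma$ with all the points of $Y$ identified to one point. Fundamental groups are based at $y_1$ and at its image in $\Sigma/Y$; a product $[p][q]$ means first $p$, then $q$. For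 $i=2,\dots,R$ fix an edge path $\gamma_i$ in $\Sigma$ from $y_1$ to $y_i$. Then: 1. The map $\psi\mapsto(\phi,g_{12},\dots,g_{1R})$, where $\phi:\pi_1(\Sigma)\to\pi_1(\Sigma/Y)\xrightarrow{\psi}G$ and $g_{1i}=\psi([\gamma_i])$, is a bijection $$\mathrm{Hom}(\pi_1(\Sigma/Y),G)\;\cong\;\mathrm{Hom}(\pi_1(\Sigma),G)\times G^{R-1}.$$ 2. Every flat $g\in G^E$ (that is, $Z_f|g\rangle=|g\rangle$ for all $f$) has a unique holonomy $\psi_g\in\mathrm{Hom}(\pi_1(\Sigma/Y),G)$, characterized by $\psi_g([q_1^{a_1}\cdots q_k^{a_k}])=g_{q_1}^{a_1}\cdots g_{q_k}^{a_k}$ for every edge path $q_1^{a_1}\cdots q_k^{a_k}$ of $\Sigma$ between two vertices of $Y$ (a loop in $\Sigma/Y$). 3. The group $H_1\times\cdots\times H_R$ acts on $\mathrm{Hom}(\pi_1(\Sigma/Y),G)$ by $$\mathbf h\cdot(\phi,g_{12},\dots,g_{1R})=(\mathrm{Ad}_{h_1}\circ\phi,\;h_1g_{12}h_2^{-1},\dots,h_1g_{1R}h_R^{-1})$$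 under the bijection in 1, and $$\mathcal C\cong\mathbb C\big[\mathrm{Hom}(\pi_1(\Sigma/Y),G)/(H_1\times\cdots\times H_R)\big]$$ by a linear isomorphism that maps the basis vector of an orbit $\omega$ to $\sum_{g}|g\rangle$, summed over the flat $g\in G^E$ with $\psi_g\in\omega$. 4. If $H_1=1$, then $$\mathcal C\cong\mathbb C[\mathrm{Hom}(\pi_1(\Sigma),G)]\otimes\mathbb C[G/H_2]\otimes\cdots\otimes\mathbb C[G/H_R]$$ by a linear isomorphism under which $\phi\otimes g_{12}H_2\otimes\cdots\otimes g_{1R}H_R$ corresponds to the basis vector of the orbit of $(\phi,g_{12},\dots,g_{1R})$ in 3. -/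

import Mathlib

noncomputable section

/-! ### Two-dimensional cell complexes and their realizations -/

/-- Edge paths in the oriented graph with vertices `V`, edges `E` and end points `src`, `tgt`.
Every edge may be crossed forwards (`fwd`) or backwards (`bwd`). -/
inductive EdgePath {V E : Type*} (src tgt : E → V) : V → V → Type _
  | nil (v : V) : EdgePath src tgt v v
  | fwd (e : E) {w : V} (p : EdgePath src tgt (tgt e) w) : EdgePath src tgt (src e) w
  | bwd (e : E) {w : V} (p : EdgePath src tgt (src e) w) : EdgePath src tgt (tgt e) w

/-- The signed edge word of an edge path; `true` is the exponent `+1`, `false` is `-1`. -/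
def EdgePath.word {V E : Type*} {src tgt : E → V} :
    {v w : V} → EdgePath src tgt v w → List (E × Bool)
  | _, _, .nil _ => []
  | _, _, .fwd e p => (e, true) :: p.word
  | _, _, .bwd e p => (e, false) :: p.word

/-- A two-dimensional complex `Σ = (V, E, F)`: oriented edges `E` between vertices `V`, and faces
`F`, each of which is glued along a closed edge path. -/
structure TwoComplex (V E F : Type*) where
  src : E → V
  tgt : E → V
  base : F → V
  boundary : ∀ f : F, EdgePath src tgt (base f) (base f)

namespace TwoComplex

variable {V E F : Type*} (K : TwoComplex V E F)

/-- Edge paths in the 1-skeleton of `K`. -/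
abbrev Walk (v w : V) := EdgePath K.src K.tgt v w

/-- Gluing of the 1-cells: the end points of `{e} × [0,1]` are the vertices `src e`, `tgt e`. -/
inductive GlueOne : (Σ _ : V, PUnit.{1}) ⊕ (Σ _ : E, unitInterval) →
    (Σ _ : V, PUnit.{1}) ⊕ (Σ _ : E, unitInterval) → Prop
  | src (e : E) : GlueOne (.inr ⟨e, 0⟩) (.inl ⟨K.src e, ⟨⟩⟩)
  | tgt (e : E) : GlueOne (.inr ⟨e, 1⟩) (.inl ⟨K.tgt e, ⟨⟩⟩)

/-- The 1-skeleton: a disjoint union of points and intervals, glued. -/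
def Skeleton : Type _ := Quot K.GlueOne

instance : TopologicalSpace K.Skeleton :=
  inferInstanceAs (TopologicalSpace (Quot K.GlueOne))

/-- The 0-cell `v` as a point of the 1-skeleton. -/
def skeletonPt (v : V) : K.Skeleton := Quot.mk _ (.inl ⟨v, ⟨⟩⟩)

/-- The characteristic map of a 1-cell, as a path from its source to its target. -/
def skeletonEdge (e : E) : Path (K.skeletonPt (K.src e)) (K.skeletonPt (K.tgt e)) where
  toFun t := Quot.mk _ (.inr ⟨e, t⟩)
  continuous_toFun := by
    refine continuous_quot_mk.comp (continuous_inr.comp ?_)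
    exact continuous_sigmaMk
  source' := Quot.sound (GlueOne.src e)
  target' := Quot.sound (GlueOne.tgt e)

/-- The continuous path in the 1-skeleton that runs along an edge path. -/
def skeletonPath : {v w : V} → K.Walk v w → Path (K.skeletonPt v) (K.skeletonPt w)
  | _, _, .nil _ => Path.refl _
  | _, _, .fwd e p => (K.skeletonEdge e).trans (skeletonPath p)
  | _, _, .bwd e p => (K.skeletonEdge e).symm.trans (skeletonPath p)

/-- The closed unit disk, the model of a 2-cell. -/
abbrev Disk := Metric.closedBall (0 : ℂ) 1

/-- The point `exp (2 π i t)` of the boundary of the disk. -/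
def diskBoundary (t : unitInterval) : Disk :=
  ⟨(Circle.exp (2 * Real.pi * (t : ℝ)) : ℂ), by
    rw [mem_closedBall_zero_iff, Circle.norm_coe]⟩

/-- Gluing of the 2-cells: the boundary circle of the disk `{f} × D²` is attached by the closed
path in the 1-skeleton that runs along `boundary f`. -/
inductive GlueTwo : K.Skeleton ⊕ (Σ _ : F, Disk) → K.Skeleton ⊕ (Σ _ : F, Disk) → Prop
  | attach (f : F) (t : unitInterval) :
      GlueTwo (.inr ⟨f, diskBoundary t⟩) (.inl (K.skeletonPath (K.boundary f) t))

/-- The topological space of the CW complex `Σ`, with the quotient topology. -/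
def Realization : Type _ := Quot K.GlueTwo

instance : TopologicalSpace K.Realization :=
  inferInstanceAs (TopologicalSpace (Quot K.GlueTwo))

/-- The inclusion of the 1-skeleton. -/
def skeletonIncl : C(K.Skeleton, K.Realization) where
  toFun x := Quot.mk _ (.inl x)
  continuous_toFun := continuous_quot_mk.comp continuous_inl

/-- The 0-cell `v` as a point of `Σ`. -/
def pt (v : V) : K.Realization := K.skeletonIncl (K.skeletonPt v)

/-- The continuous path in `Σ` that runs along an edge path. -/
def path {v w : V} (p : K.Walk v w) : Path (K.pt v) (K.pt w) :=
  (K.skeletonPath p).map K.skeletonIncl.continuous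

/-- The quotient space `Σ/Y` in which all vertices of `Y` become a single point. -/
def GhostQuotient (Y : Set V) : Type _ :=
  Quot fun x z : K.Realization => x ∈ K.pt '' Y ∧ z ∈ K.pt '' Y

instance (Y : Set V) : TopologicalSpace (K.GhostQuotient Y) :=
  inferInstanceAs (TopologicalSpace
    (Quot fun x z : K.Realization => x ∈ K.pt '' Y ∧ z ∈ K.pt '' Y))

/-- The quotient map `Σ → Σ/Y`. -/
def ghostProj (Y : Set V) : C(K.Realization, K.GhostQuotient Y) where
  toFun x := Quot.mk _ x
  continuous_toFun := continuous_quot_mk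

theorem ghostProj_pt (Y : Set V) (a b : Y) :
    K.ghostProj Y (K.pt a) = K.ghostProj Y (K.pt b) :=
  Quot.sound ⟨⟨a, a.2, rfl⟩, ⟨b, b.2, rfl⟩⟩

/-- An edge path in `Σ` between two vertices of `Y` is a loop in `Σ/Y`. -/
def ghostLoop (Y : Set V) (y₁ : Y) {a b : Y} (p : K.Walk a b) :
    Path (K.ghostProj Y (K.pt y₁)) (K.ghostProj Y (K.pt y₁)) :=
  ((K.path p).map (K.ghostProj Y).continuous).cast
    (K.ghostProj_pt Y y₁ a) (K.ghostProj_pt Y y₁ b)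

end TwoComplex

/-- The fundamental group with the convention that the product `[p] * [q]` is the class of the
loop "first `p`, then `q`". Mathlib's `FundamentalGroup` multiplies loops in the opposite order. -/
abbrev LoopGroup (X : Type*) [TopologicalSpace X] (x : X) := (FundamentalGroup X x)ᵐᵒᵖ

/-- The class of a loop in the fundamental group. -/
def LoopGroup.mk {X : Type*} [TopologicalSpace X] {x : X} (p : Path x x) : LoopGroup X x :=
  MulOpposite.op (FundamentalGroup.fromPath (Path.Homotopic.Quotient.mk p))

theorem LoopGroup.mk_mul_mk {X : Type*} [TopologicalSpace X] {x : X} (p q : Path x x) :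
    LoopGroup.mk p * LoopGroup.mk q = LoopGroup.mk (p.trans q) := rfl

/-- The homomorphism of fundamental groups induced by a continuous map. -/
def LoopGroup.map {X Z : Type*} [TopologicalSpace X] [TopologicalSpace Z] (f : C(X, Z)) (x : X) :
    LoopGroup X x →* LoopGroup Z (f x) :=
  MonoidHom.op (FundamentalGroup.map f x)

theorem LoopGroup.map_mk {X Z : Type*} [TopologicalSpace X] [TopologicalSpace Z] (f : C(X, Z))
    {x : X} (p : Path x x) :
    LoopGroup.map f x (LoopGroup.mk p) = LoopGroup.mk (p.map f.continuous) := rfl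

/-! ### Group CSS codes -/

namespace GroupCSS

variable {E G : Type*} [Group G]

/-- The physical Hilbert space `ℂ[G^n]`, with one `G`-qudit for each element of `E`. -/
abbrev HilbertSpace (E G : Type*) := (E → G) →₀ ℂ

/-- The basis state `|g⟩`. -/
abbrev ket (g : E → G) : HilbertSpace E G := Finsupp.single g 1

/-- The value `g_{q₁}^{a₁} ⋯ g_{q_j}^{a_j}` of a signed word of qudits. -/
def evalWord (g : E → G) (w : List (E × Bool)) : G :=
  (w.map fun q => if q.2 then g q.1 else (g q.1)⁻¹).prod

/-- The X-check `X^{a,b}`, which maps `|g⟩` to `|a g b⁻¹⟩`. -/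
def xCheck (a b : E → G) : HilbertSpace E G →ₗ[ℂ] HilbertSpace E G :=
  Finsupp.lmapDomain ℂ ℂ fun g e => a e * g e * (b e)⁻¹

open Classical in
/-- The Z-check of a word `w` and a subgroup `L`, which multiplies `|g⟩` by the indicator of
`evalWord g w ∈ L`. -/
def zCheck (L : Subgroup G) (w : List (E × Bool)) : HilbertSpace E G →ₗ[ℂ] HilbertSpace E G :=
  Finsupp.linearCombination ℂ fun g => if evalWord g w ∈ L then ket g else 0

/-- The joint `+1`-eigenspace of a set of checks. -/
def codespace (S : Set (HilbertSpace E G →ₗ[ℂ] HilbertSpace E G)) :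
    Submodule ℂ (HilbertSpace E G) :=
  ⨅ T ∈ S, LinearMap.ker (T - LinearMap.id)

/-- The (unnormalized) equal superposition of the basis states in `S`. -/
def superposition [Finite E] [Finite G] (S : Set (E → G)) : HilbertSpace E G :=
  Finsupp.equivFunOnFinite.symm (S.indicator fun _ => 1)

end GroupCSS

/-! ### Quantum double codes with ghost vertices -/

namespace TwoComplex

open GroupCSS

variable {V E F G : Type*} [Group G] (K : TwoComplex V E F)

open Classical in
/-- The X-check `X_v^h` of a vertex: left multiplication by `h` on the edges that leave `v`, right
multiplication by `h⁻¹` on the edges that enter `v`. -/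
def vertexCheck (v : V) (h : G) : HilbertSpace E G →ₗ[ℂ] HilbertSpace E G :=
  xCheck (fun e => if K.src e = v then h else 1) (fun e => if K.tgt e = v then h else 1)

/-- The Z-check of a face: the holonomy around its boundary is `1`. -/
def faceCheck (G : Type*) [Group G] (f : F) : HilbertSpace E G →ₗ[ℂ] HilbertSpace E G :=
  zCheck (⊥ : Subgroup G) (K.boundary f).word

/-- The codespace of the quantum double code on `K` in which the vertices `y ∈ Y` are ghost
vertices with subgroups `H y`: X-checks `X_v^h` for all `h ∈ G` at the vertices outside `Y`,
X-checks `X_y^h` for `h ∈ H y` only at `y ∈ Y`, and the Z-checks of all faces. -/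
def quantumDouble (Y : Set V) (H : Y → Subgroup G) : Submodule ℂ (HilbertSpace E G) :=
  codespace ({T | ∃ v, v ∉ Y ∧ ∃ h : G, T = K.vertexCheck v h} ∪
    {T | ∃ y : Y, ∃ h ∈ H y, T = K.vertexCheck (y : V) h} ∪
    {T | ∃ f : F, T = K.faceCheck G f})

/-- A connection is flat if its holonomy around every face is trivial. -/
def IsFlat (g : E → G) : Prop := ∀ f : F, evalWord g (K.boundary f).word = 1

/-- `ψ : π₁(Σ/Y) → G` is the holonomy of the connection `g`: for every edge path `p` of `Σ` between
vertices of `Y`, `ψ` maps the class of the loop `p` of `Σ/Y` to the product of `g` along `p`. -/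
def IsHolonomy (Y : Set V) (y₁ : Y) (g : E → G)
    (ψ : LoopGroup (K.GhostQuotient Y) (K.ghostProj Y (K.pt y₁)) →* G) : Prop :=
  ∀ (a b : Y) (p : K.Walk a b), ψ (LoopGroup.mk (K.ghostLoop Y y₁ p)) = evalWord g p.word

/-- The data `(φ, (g_{1i})_i)` of `ψ : π₁(Σ/Y) → G`: the restriction `φ` of `ψ` to loops in `Σ`
based at `y₁`, and the values `g_{1i}` of `ψ` on chosen edge paths from `y₁` to the other ghost
vertices. -/
def holonomyData (Y : Set V) (y₁ : Y) (γ : ∀ y : {y : Y // y ≠ y₁}, K.Walk y₁ y.1)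
    (ψ : LoopGroup (K.GhostQuotient Y) (K.ghostProj Y (K.pt y₁)) →* G) :
    (LoopGroup K.Realization (K.pt y₁) →* G) × ({y : Y // y ≠ y₁} → G) :=
  (ψ.comp (LoopGroup.map (K.ghostProj Y) (K.pt y₁)),
    fun y => ψ (LoopGroup.mk (K.ghostLoop Y y₁ (γ y))))

end TwoComplex

end

/-! Two facts stand in for a presentation of `π₁(Σ/Y)`. The edge paths between ghost vertices
generate it (`ghostSubgroup_eq_top`), so a homomorphism is determined by its values on them.
Conversely, every flat connection comes from a homomorphism (`exists_isHolonomy`).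

Generation: let `N` be the subgroup generated by these edge paths, and choose a standard path from
the base point to every point of `Σ/Y`. The paths that land in `N` when closed up by the chosen
paths form a `PathSystem`. Membership in a path system is a local question, and when cells are
attached to a space it suffices to know the paths of that space and those inside the cells
(`CellAttachment.mem_pathSystem`). This is applied to the passage from vertices to 1-skeleton and
from 1-skeleton to `Σ/Y`.

Existence: write `G` as `π₁(B)`, where `B` is the quotient of a contractible space by a free action
of `G`. A connection `g` sends all vertices to the base point of `B` and the edge `e` to a loop of
class `g e`. Flatness says that face boundaries become null-homotopic, so the map extends over the
disks. It is constant on vertices, hence descends to `Σ/Y`, and it induces the holonomy on `π₁`.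

The bijection: if `δ v` is an edge path from `y₁` to `v` that equals the given `γ` at ghost
vertices, then `δ_a p δ_b⁻¹` is a loop in `Σ`, so the data determine the value on `p`. Given data
`(φ, c)`, extend `c` by `1` to `k : V → G`. The connection `k_v⁻¹ φ(δ_v p δ_w⁻¹) k_w` is flat, and
its holonomy has these data.

The code: the Z-checks force support on flat connections. The X-checks generate the gauge group of
all `k : V → G` with `k y ∈ H y`, so codewords are the functions constant on its orbits. Gauge
transformations act on holonomy data by the stated formula, and flat connections with equal holonomy
differ by a gauge transformation that is `1` on `Y`. Hence gauge orbits correspond to orbits of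
holonomies. If `H y₁` is trivial, the action fixes `φ` and only multiplies each `c y` on the right
by `H y`, so the orbits are tuples of cosets. -/

noncomputable section

/-! ### A space with a prescribed fundamental group -/

/-- Arbitrary functions on `(0,1]`, with the distance `volume {u ≠ v}`. -/
def StepSpace (G : Type*) := Set.Ioc (0 : ℝ) 1 → G

namespace StepSpace

variable {G : Type*}

/-- The set where two functions differ. -/
def diff (u v : StepSpace G) : Set ℝ := Subtype.val '' {t | u t ≠ v t}

theorem diff_subset (u v : StepSpace G) : diff u v ⊆ Set.Ioc 0 1 := by
  rintro _ ⟨t, -, rfl⟩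
  exact t.2

theorem volume_diff_ne_top (u v : StepSpace G) : MeasureTheory.volume (diff u v) ≠ ⊤ :=
  ne_top_of_le_ne_top (by simp) (MeasureTheory.measure_mono (diff_subset u v))

/-- Only monotonicity and subadditivity of the outer measure enter, so the functions need not be
measurable. Functions that differ on a null set are at distance zero. -/
instance : PseudoMetricSpace (StepSpace G) where
  dist u v := (MeasureTheory.volume (diff u v)).toReal
  dist_self u := by simp [diff]
  dist_comm u v := by simp only [diff, ne_comm]
  dist_triangle u v w := by
    rw [← ENNReal.toReal_add (volume_diff_ne_top u v) (volume_diff_ne_top v w)]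
    refine ENNReal.toReal_mono
      (ENNReal.add_ne_top.2 ⟨volume_diff_ne_top u v, volume_diff_ne_top v w⟩)
      ((MeasureTheory.measure_mono ?_).trans (MeasureTheory.measure_union_le _ _))
    rintro _ ⟨t, ht, rfl⟩
    by_cases h : u t = v t
    · exact Or.inr ⟨t, fun h' => ht (h.trans h'), rfl⟩
    · exact Or.inl ⟨t, h, rfl⟩

theorem dist_def (u v : StepSpace G) : dist u v = (MeasureTheory.volume (diff u v)).toReal := rfl

variable [Group G]

instance : MulAction G (StepSpace G) where
  smul g u := fun t => g * u t
  one_smul u := funext fun t => one_mul (u t)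
  mul_smul g h u := funext fun t => mul_assoc g h (u t)

theorem smul_apply (g : G) (u : StepSpace G) (t) : (g • u) t = g * u t := rfl

instance : ContinuousConstSMul G (StepSpace G) where
  continuous_const_smul g := by
    refine (Isometry.of_dist_eq fun u v => ?_).continuous
    simp [dist_def, diff, smul_apply]

/-- Translation by `g ≠ 1` changes every value of a function, so it moves each point by exactly the
length of `(0,1]`. -/
theorem eq_one_of_dist_smul_lt_one {g : G} {u : StepSpace G} (h : dist (g • u) u < 1) :
    g = 1 := by
  by_contra hg
  refine h.ne ?_
  have : diff (g • u) u = Set.Ioc 0 1 := by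
    simp [diff, smul_apply, hg]
    rfl
  rw [dist_def, this]
  simp

/-- The contraction of `StepSpace G`: at time `r` all values on `(0,r]` are set to `1`. -/
def contract (r : unitInterval) (u : StepSpace G) : StepSpace G :=
  fun t => if (t : ℝ) ≤ r then 1 else u t

/-- The contracted functions can differ only where `u` and `v` differ or between `r` and `r'`. This
yields continuity in both variables together. -/
theorem dist_contract_le (r r' : unitInterval) (u v : StepSpace G) :
    dist (contract r u) (contract r' v) ≤ dist u v + dist r r' := by
  have h : MeasureTheory.volume (diff (contract r u) (contract r' v)) ≤
      MeasureTheory.volume (diff u v) + MeasureTheory.volume (Set.uIoc (r : ℝ) r') := by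
    refine (MeasureTheory.measure_mono ?_).trans (MeasureTheory.measure_union_le _ _)
    rintro _ ⟨t, ht, rfl⟩
    by_cases h : u t = v t
    · refine Or.inr ?_
      simp only [contract, h, Set.mem_ofPred_eq] at ht
      rw [Set.mem_uIoc]
      by_cases h1 : (t : ℝ) ≤ r <;> by_cases h2 : (t : ℝ) ≤ r' <;> simp [h1, h2] at ht ⊢
      all_goals grind
    · exact Or.inl ⟨t, h, rfl⟩
  have h2 : MeasureTheory.volume (Set.uIoc (r : ℝ) r') ≠ ⊤ := by simp
  have := ENNReal.toReal_mono (ENNReal.add_ne_top.2 ⟨volume_diff_ne_top u v, h2⟩) h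
  rw [ENNReal.toReal_add (volume_diff_ne_top u v) h2] at this
  refine this.trans (add_le_add le_rfl ?_)
  simp [Subtype.dist_eq, Real.dist_eq, abs_sub_comm]

theorem continuous_contract :
    Continuous fun p : unitInterval × StepSpace G => contract p.1 p.2 := by
  refine LipschitzWith.continuous (K := 2) (LipschitzWith.of_dist_le_mul fun p q => ?_)
  refine (dist_contract_le _ _ _ _).trans ?_
  have h1 := le_max_left (dist p.1 q.1) (dist p.2 q.2)
  have h2 := le_max_right (dist p.1 q.1) (dist p.2 q.2)
  rw [Prod.dist_eq]
  push_cast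
  linarith

instance : ContractibleSpace (StepSpace G) := by
  rw [contractible_iff_id_nullhomotopic]
  -- The interval is open at `0`, so nothing is reset at time `0`; it is closed at `1`, so
  -- everything is reset at time `1`.
  refine ⟨fun _ => 1, ⟨⟨⟨fun p => contract p.1 p.2, continuous_contract⟩, fun u => ?_, fun u => ?_⟩⟩⟩
  · funext t
    simp [contract, not_le.2 t.2.1]
  · funext t
    simp [contract, t.2.2]
    rfl

theorem isQuotientCoveringMap :
    IsQuotientCoveringMap (Quotient.mk (MulAction.orbitRel G (StepSpace G))) G where
  __ := isQuotientMap_quotient_mk'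
  apply_eq_iff_mem_orbit := Quotient.eq''
  disjoint e := by
    -- If `u` and `g • u` lie in the same ball of radius `1/2`, their distance is less than `1`.
    refine ⟨Metric.ball e (1 / 2), Metric.ball_mem_nhds _ (by norm_num), fun g => ?_⟩
    rintro ⟨_, ⟨u, hu, rfl⟩, hgu⟩
    refine eq_one_of_dist_smul_lt_one (u := u) ((dist_triangle_right _ _ e).trans_lt ?_)
    rw [Metric.mem_ball] at hu hgu
    change dist (g • u) e < _ at hgu
    linarith

end StepSpace

/-- Every group is a fundamental group. -/
theorem exists_loopGroup_mulEquiv.{u} (G : Type u) [Group G] :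
    ∃ (B : Type u) (_ : TopologicalSpace B) (b : B), Nonempty (LoopGroup B b ≃* G) := by
  let e : StepSpace G := fun _ => 1
  refine ⟨MulAction.orbitRel.Quotient G (StepSpace G), inferInstance,
    Quotient.mk (MulAction.orbitRel G (StepSpace G)) e, ⟨?_⟩⟩
  -- The total space is contractible, hence simply connected, so the covering group gives the
  -- fundamental group up to the order of multiplication. The opposite in `LoopGroup` undoes that
  -- reversal.
  exact (MulEquiv.op (StepSpace.isQuotientCoveringMap.fundamentalGroupEquiv ⟨e, rfl⟩)).trans
    (MulEquiv.opOp G).symm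

end
noncomputable section

namespace TwoComplex

open unitInterval

/-! ### The disk in polar coordinates -/

theorem continuous_diskBoundary : Continuous diskBoundary := by
  unfold diskBoundary
  fun_prop

theorem norm_diskBoundary (t : I) : ‖(diskBoundary t : ℂ)‖ = 1 := Circle.norm_coe _

theorem diskBoundary_zero : diskBoundary 0 = diskBoundary 1 := by
  simp [diskBoundary]

theorem exists_diskBoundary_eq {z : Disk} (hz : ‖(z : ℂ)‖ = 1) : ∃ t, diskBoundary t = z := by
  let w : Circle := ⟨z, by simpa [Submonoid.unitSphere] using hz⟩
  obtain ⟨x, hx⟩ := Circle.surjOn_exp_neg_pi_pi (Set.mem_univ w)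
  obtain ⟨hx, hxw⟩ := hx
  have hpi := Real.pi_pos
  rcases le_or_gt 0 x with h | h
  · refine ⟨⟨x / (2 * Real.pi), by positivity, ?_⟩, Subtype.ext ?_⟩
    · rw [div_le_one (by positivity)]
      linarith [hx.2]
    · simp only [diskBoundary]
      rw [mul_div_cancel₀ _ (by positivity), hxw]
  · refine ⟨⟨(x + 2 * Real.pi) / (2 * Real.pi), ?_, ?_⟩, Subtype.ext ?_⟩
    · have := hx.1
      exact div_nonneg (by linarith) (by positivity)
    · rw [div_le_one (by positivity)]
      linarith
    · simp only [diskBoundary]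
      rw [mul_div_cancel₀ _ (by positivity), Circle.exp_add_two_pi, hxw]

theorem eq_or_eq_of_diskBoundary_eq {s t : I} (h : diskBoundary s = diskBoundary t) :
    s = t ∨ s = 0 ∧ t = 1 ∨ s = 1 ∧ t = 0 := by
  have h1 : Circle.exp (2 * Real.pi * s) = Circle.exp (2 * Real.pi * t) :=
    Circle.ext (congrArg (fun z : Disk => (z : ℂ)) h)
  obtain ⟨m, hm⟩ := Circle.exp_eq_exp.1 h1
  have hst : (s : ℝ) = t + m := by
    have : (2 * Real.pi) * (s : ℝ) = (2 * Real.pi) * (t + m) := by rw [hm]; ring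
    exact mul_left_cancel₀ (by positivity) this
  have hs0 := s.2.1
  have hs1 := s.2.2
  have ht0 := t.2.1
  have ht1 := t.2.2
  have hm1 : m ≤ 1 := by
    by_contra hc
    have : (2 : ℝ) ≤ m := by exact_mod_cast (by omega : (2 : ℤ) ≤ m)
    linarith
  have hm2 : -1 ≤ m := by
    by_contra hc
    have : (m : ℝ) ≤ -2 := by exact_mod_cast (by omega : m ≤ (-2 : ℤ))
    linarith
  interval_cases m
  · right; left
    push_cast at hst
    exact ⟨Subtype.ext (show (s : ℝ) = 0 by linarith), Subtype.ext (show (t : ℝ) = 1 by linarith)⟩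
  · left
    exact Subtype.ext (by simpa using hst)
  · right; right
    push_cast at hst
    exact ⟨Subtype.ext (show (s : ℝ) = 1 by linarith), Subtype.ext (show (t : ℝ) = 0 by linarith)⟩

/-- Polar coordinates on the disk: the point with radius `1 - s` and angle `2 π t`. -/
def diskPolar (p : I × I) : Disk :=
  ⟨(1 - (p.1 : ℝ) : ℝ) * (diskBoundary p.2 : ℂ), by
    rw [mem_closedBall_zero_iff, norm_mul, norm_diskBoundary, mul_one, Complex.norm_real,
      Real.norm_of_nonneg (by linarith [p.1.2.2])]
    linarith [p.1.2.1]⟩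

theorem continuous_diskPolar : Continuous diskPolar := by
  unfold diskPolar
  have := continuous_diskBoundary
  fun_prop

theorem norm_diskPolar (p : I × I) : ‖(diskPolar p : ℂ)‖ = 1 - p.1 := by
  rw [diskPolar, norm_mul, norm_diskBoundary, mul_one, Complex.norm_real,
    Real.norm_of_nonneg (by linarith [p.1.2.2])]

theorem diskPolar_zero (t : I) : diskPolar (0, t) = diskBoundary t :=
  Subtype.ext (by simp [diskPolar])

theorem diskPolar_surjective : Function.Surjective diskPolar := by
  intro z
  have hz : ‖(z : ℂ)‖ ≤ 1 := mem_closedBall_zero_iff.1 z.2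
  by_cases h0 : (z : ℂ) = 0
  · exact ⟨(1, 0), Subtype.ext (by simp [diskPolar, h0])⟩
  · have hn : ‖(z : ℂ)‖ ≠ 0 := norm_ne_zero_iff.2 h0
    have hw : ‖((‖(z : ℂ)‖⁻¹ : ℝ) * (z : ℂ))‖ = 1 := by
      rw [norm_mul, Complex.norm_real, norm_inv, norm_norm, inv_mul_cancel₀ hn]
    obtain ⟨t, ht⟩ := exists_diskBoundary_eq (z := ⟨_, mem_closedBall_zero_iff.2 hw.le⟩) hw
    refine ⟨(⟨1 - ‖(z : ℂ)‖, by linarith, by linarith [norm_nonneg (z : ℂ)]⟩, t), Subtype.ext ?_⟩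
    simp only [diskPolar, ht]
    rw [sub_sub_cancel, ← mul_assoc, ← Complex.ofReal_mul, mul_inv_cancel₀ hn]
    simp

/-- A continuous surjection from a compact space to a Hausdorff space is a quotient map. -/
theorem isQuotientMap_diskPolar : Topology.IsQuotientMap diskPolar :=
  Topology.IsQuotientMap.of_surjective_continuous diskPolar_surjective continuous_diskPolar

theorem diskPolar_eq_iff {p q : I × I} (h : diskPolar p = diskPolar q) :
    p.1 = q.1 ∧ (p.1 = 1 ∨ diskBoundary p.2 = diskBoundary q.2) := by
  have h1 : p.1 = q.1 := by
    have := congrArg (fun z : Disk => ‖(z : ℂ)‖) h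
    simp only [norm_diskPolar] at this
    exact Subtype.ext (by linarith)
  refine ⟨h1, or_iff_not_imp_left.2 fun hp => Subtype.ext ?_⟩
  have h2 := congrArg Subtype.val h
  simp only [diskPolar, ← h1] at h2
  refine mul_left_cancel₀ ?_ h2
  rw [Complex.ofReal_ne_zero, sub_ne_zero]
  exact fun hc => hp (Subtype.ext hc.symm)

/-- Continuous maps on the disk in polar coordinates. -/
theorem exists_disk_lift {B : Type*} [TopologicalSpace B] (F : C(I × I, B))
    (hc : ∀ t, F (1, t) = F (1, 0)) (hF : ∀ s, F (s, 0) = F (s, 1)) :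
    ∃ f : C(Disk, B), ∀ p, f (diskPolar p) = F p := by
  have hinv : ∀ p q, diskPolar p = diskPolar q → F p = F q := by
    rintro ⟨s, t⟩ ⟨s', t'⟩ h
    obtain ⟨h1, h2⟩ := diskPolar_eq_iff h
    simp only at h1 h2
    subst h1
    rcases h2 with rfl | h2
    · rw [hc t, hc t']
    · rcases eq_or_eq_of_diskBoundary_eq h2 with rfl | ⟨rfl, rfl⟩ | ⟨rfl, rfl⟩
      · rfl
      · exact hF s
      · exact (hF s).symm
  let q : C(I × I, Disk) := ⟨diskPolar, continuous_diskPolar⟩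
  have hq : Topology.IsQuotientMap q := isQuotientMap_diskPolar
  refine ⟨hq.lift F fun p p' h => hinv p p' h, fun p => ?_⟩
  exact DFunLike.congr_fun (hq.lift_comp F fun p p' h => hinv p p' h) p

/-- A null-homotopic loop extends over the disk. -/
theorem exists_disk_extension {B : Type*} [TopologicalSpace B] {b : B} (l : Path b b)
    (hl : l.Homotopic (Path.refl b)) : ∃ f : C(Disk, B), ∀ t, f (diskBoundary t) = l t := by
  obtain ⟨F⟩ := hl
  -- The homotopy is read in polar coordinates, its time being the distance from the boundary
  -- circle. At time `1` it is constant, as the centre requires, and its fixed end points make the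
  -- two sides of the cut agree.
  obtain ⟨f, hf⟩ := exists_disk_lift F.toContinuousMap (fun t => by simp) (fun s => by simp)
  refine ⟨f, fun t => ?_⟩
  rw [← diskPolar_zero, hf]
  simp

/-- The boundary circle of the disk. -/
def diskSphere : Set Disk := {z | ‖(z : ℂ)‖ = 1}

/-- Continuous maps on the boundary circle are loops. -/
theorem exists_sphere_lift {A : Type*} [TopologicalSpace A] (l : C(I, A)) (hl : l 0 = l 1) :
    ∃ f : C(diskSphere, A), ∀ t, f ⟨diskBoundary t, norm_diskBoundary t⟩ = l t := by
  let q : C(I, diskSphere) := ⟨fun t => ⟨diskBoundary t, norm_diskBoundary t⟩,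
    continuous_diskBoundary.subtype_mk _⟩
  have hq : Topology.IsQuotientMap q := by
    refine Topology.IsQuotientMap.of_surjective_continuous ?_ q.continuous
    rintro ⟨z, hz⟩
    obtain ⟨t, rfl⟩ := exists_diskBoundary_eq hz
    exact ⟨t, rfl⟩
  have hinv : ∀ s t, q s = q t → l s = l t := by
    intro s t h
    rcases eq_or_eq_of_diskBoundary_eq (congrArg Subtype.val h) with
      rfl | ⟨rfl, rfl⟩ | ⟨rfl, rfl⟩
    · rfl
    · exact hl
    · exact hl.symm
  refine ⟨hq.lift l hinv, fun t => ?_⟩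
  exact DFunLike.congr_fun (hq.lift_comp l hinv) t

instance : ContractibleSpace Disk :=
  (convex_closedBall (0 : ℂ) 1).contractibleSpace ⟨0, by simp⟩

instance : ContractibleSpace I :=
  (convex_Icc (0 : ℝ) 1).contractibleSpace ⟨0, by simp⟩

end TwoComplex

end
-- Path systems and the attachment of cells
noncomputable section

open unitInterval

/-- A class of paths that contains the constant paths and is closed under homotopy, reversal and
concatenation. -/
structure PathSystem (X : Type*) [TopologicalSpace X] where
  /-- Membership of a path. -/
  Mem : ∀ {x y : X}, Path x y → Prop
  refl : ∀ x : X, Mem (Path.refl x)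
  symm : ∀ {x y : X} {p : Path x y}, Mem p → Mem p.symm
  trans : ∀ {x y z : X} {p : Path x y} {q : Path y z}, Mem p → Mem q → Mem (p.trans q)
  homotopic : ∀ {x y : X} {p q : Path x y}, p.Homotopic q → Mem p → Mem q

namespace PathSystem

variable {X : Type*} [TopologicalSpace X] (S : PathSystem X)

/-- Membership depends only on the underlying function, which removes all transport along equalities
of end points. -/
theorem of_eq {x y x' y' : X} {p : Path x y} {q : Path x' y'} (h : ∀ t, p t = q t)
    (hp : S.Mem p) : S.Mem q := by
  obtain rfl : x = x' := by simpa using h 0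
  obtain rfl : y = y' := by simpa using h 1
  obtain rfl : p = q := Path.ext (funext h)
  exact hp

theorem of_const {x y : X} {p : Path x y} (h : ∀ t, p t = x) : S.Mem p :=
  S.of_eq (fun t => (h t).symm) (S.refl x)

/-- The preimage of a path system. -/
def comap {A : Type*} [TopologicalSpace A] (f : C(A, X)) : PathSystem A where
  Mem p := S.Mem (p.map f.continuous)
  refl a := S.of_const fun _ => rfl
  symm hp := S.of_eq (fun _ => rfl) (S.symm hp)
  trans {_ _ _ p q} hp hq := by
    rw [Path.map_trans]
    exact S.trans hp hq
  homotopic h hp := S.homotopic (h.map f) hp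

/-- One side of a square is in the system if the other three are. -/
theorem of_square (F : C(I × I, X)) {x₀ x₁ y₀ y₁ : X} {b : Path x₀ x₁} {t : Path y₀ y₁}
    {l : Path x₀ y₀} {r : Path x₁ y₁} (hb : ∀ s, F (0, s) = b s) (ht : ∀ s, F (1, s) = t s)
    (hl : ∀ s, F (s, 0) = l s) (hr : ∀ s, F (s, 1) = r s)
    (hbl : S.Mem l) (hbr : S.Mem r) (hbt : S.Mem t) : S.Mem b := by
  let pb : Path ((0 : I), (0 : I)) (0, 1) := ⟨⟨fun s => (0, s), by fun_prop⟩, rfl, rfl⟩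
  let pt : Path ((1 : I), (0 : I)) (1, 1) := ⟨⟨fun s => (1, s), by fun_prop⟩, rfl, rfl⟩
  let pl : Path ((0 : I), (0 : I)) (1, 0) := ⟨⟨fun s => (s, 0), by fun_prop⟩, rfl, rfl⟩
  let pr : Path ((0 : I), (1 : I)) (1, 1) := ⟨⟨fun s => (s, 1), by fun_prop⟩, rfl, rfl⟩
  -- In the simply connected square, one side is homotopic to the path along the other three.
  have h : (S.comap F).Mem ((pl.trans pt).trans pr.symm) :=
    (S.comap F).trans ((S.comap F).trans (S.of_eq (fun s => (hl s).symm) hbl)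
      (S.of_eq (fun s => (ht s).symm) hbt))
      ((S.comap F).symm (S.of_eq (fun s => (hr s).symm) hbr))
  exact S.of_eq hb ((S.comap F).homotopic (SimplyConnectedSpace.paths_homotopic _ pb) h)

/-- A path is in the system if it is locally. -/
theorem of_locally {x y : X} (p : Path x y) {ι : Type*} (U : ι → Set X) (hU : ∀ i, IsOpen (U i))
    (hcov : ∀ t, ∃ i, p t ∈ U i)
    (hS : ∀ (i : ι) {x' y' : X} (q : Path x' y'), (∀ t, q t ∈ U i) → S.Mem q) : S.Mem p := by
  obtain ⟨t, ht0, hmono, ⟨m, hm⟩, hsub⟩ :=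
    exists_monotone_Icc_subset_open_cover_unitInterval (c := fun i => p ⁻¹' U i)
      (fun i => (hU i).preimage p.continuous)
      (fun s _ => Set.mem_iUnion.2 (hcov s))
  -- After subdivision of `I` by a Lebesgue number argument, each short piece lies in one `U i`; the
  -- initial segments of `p` are built up piece by piece.
  have key : ∀ n, S.Mem (p.subpath 0 (t n)) := by
    intro n
    induction n with
    | zero => exact S.of_const fun s => by rw [ht0, Path.subpath_self]; rfl
    | succ n ih =>
      obtain ⟨i, hi⟩ := hsub n
      refine S.homotopic ⟨Path.Homotopy.subpathTransSubpath p 0 (t n) (t (n + 1))⟩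
        (S.trans ih (hS i _ fun s => ?_))
      have := Set.mem_range_self (f := p.subpath (t n) (t (n + 1))) s
      rw [Path.range_subpath_of_le _ _ _ (hmono n.le_succ)] at this
      obtain ⟨s', hs', hs''⟩ := this
      rw [← hs'']
      exact hi hs'
  refine S.of_eq (fun s => ?_) (key m)
  rw [hm m le_rfl, Path.subpath_zero_one]
  rfl

end PathSystem

/-- A space obtained from `A` by attaching cells `D`, one for each `j : J`. The cell `D` has
boundary `bdry`, and the complement of the `core` can be pushed into the boundary. -/
structure CellAttachment (A J D X : Type*) [TopologicalSpace A] [TopologicalSpace D]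
    [TopologicalSpace X] where
  /-- The inclusion of `A`. -/
  incl : C(A, X)
  /-- The characteristic maps. -/
  char : J → C(D, X)
  bdry : Set D
  core : Set D
  isClosed_bdry : IsClosed bdry
  isClosed_core : IsClosed core
  disjoint : ∀ z ∈ core, z ∉ bdry
  /-- The attaching maps. -/
  att : J → C(bdry, A)
  incl_att : ∀ j z, incl (att j z) = char j z
  /-- The deformation that pushes the complement of the core into the boundary. -/
  push : C(I × D, D)
  push_zero : ∀ z, push (0, z) = z
  push_bdry : ∀ t, ∀ z ∈ bdry, push (t, z) = z
  push_one : ∀ z, z ∉ core → push (1, z) ∈ bdry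
  isQuotientMap : Topology.IsQuotientMap
    (Sum.elim incl fun p : Σ _ : J, D => char p.1 p.2)
  /-- The cell in which a point lies. -/
  normal : X → A ⊕ (Σ _ : J, D)
  normal_incl : ∀ a, normal (incl a) = .inl a
  normal_char : ∀ j z, z ∉ bdry → normal (char j z) = .inr ⟨j, z⟩

namespace CellAttachment

variable {A J D X : Type*} [TopologicalSpace A] [TopologicalSpace D] [TopologicalSpace X]
  (K : CellAttachment A J D X)

/-- The map `normal`, which need not be continuous, separates the points of `A` from each other and
from the open cells. This and the next two results are read off from it. -/
theorem incl_injective : Function.Injective K.incl := fun a b h => by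
  have := congrArg K.normal h
  rwa [K.normal_incl, K.normal_incl, Sum.inl.injEq] at this

theorem incl_ne_char {a : A} {j : J} {z : D} (hz : z ∉ K.bdry) : K.incl a ≠ K.char j z := by
  intro h
  have := congrArg K.normal h
  rw [K.normal_incl, K.normal_char j z hz] at this
  cases this

theorem char_eq {j k : J} {z w : D} (hz : z ∉ K.bdry) (h : K.char j z = K.char k w) :
    j = k ∧ z = w := by
  have hw : w ∉ K.bdry := fun hw => K.incl_ne_char hz ((K.incl_att k ⟨w, hw⟩).trans h.symm)
  have := congrArg K.normal h
  rw [K.normal_char j z hz, K.normal_char k w hw, Sum.inr.injEq] at this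
  cases this
  exact ⟨rfl, rfl⟩

theorem exists_eq (x : X) : (∃ a, x = K.incl a) ∨ ∃ j z, z ∉ K.bdry ∧ x = K.char j z := by
  obtain ⟨a | ⟨j, z⟩, rfl⟩ := K.isQuotientMap.surjective x
  · exact Or.inl ⟨a, rfl⟩
  · by_cases hz : z ∈ K.bdry
    · exact Or.inl ⟨_, (K.incl_att j ⟨z, hz⟩).symm⟩
    · exact Or.inr ⟨j, z, hz, rfl⟩

theorem isOpen_iff {U : Set X} :
    IsOpen U ↔ IsOpen (K.incl ⁻¹' U) ∧ ∀ j, IsOpen (K.char j ⁻¹' U) := by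
  rw [← K.isQuotientMap.isOpen_preimage, isOpen_sum_iff, isOpen_sigma_iff]
  rfl

/-- The deformation of `X` that pushes the complement of the cores into `A`. -/
def deform (p : I × X) : X :=
  match K.normal p.2 with
  | .inl a => K.incl a
  | .inr q => K.char q.1 (K.push (p.1, q.2))

theorem deform_incl (t : I) (a : A) : K.deform (t, K.incl a) = K.incl a := by
  simp only [deform, K.normal_incl]

theorem deform_char (t : I) (j : J) (z : D) :
    K.deform (t, K.char j z) = K.char j (K.push (t, z)) := by
  by_cases hz : z ∈ K.bdry
  · rw [K.push_bdry t z hz, ← K.incl_att j ⟨z, hz⟩, K.deform_incl]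
  · simp only [deform, K.normal_char j z hz]

/-- The product of a quotient map with the locally compact space `I` is again a quotient map, so
continuity is tested on `A` and on each cell. -/
theorem continuous_deform : Continuous K.deform := by
  refine K.isQuotientMap.continuous_lift_prod_right ?_
  have h1 : Continuous fun p : I × A => K.deform (p.1, K.incl p.2) := by
    simp only [deform_incl]
    fun_prop
  have h2 : Continuous fun p : I × (Σ _ : J, D) => K.deform (p.1, K.char p.2.1 p.2.2) := by
    simp only [deform_char]
    have h3 : Continuous fun p : (Σ _ : J, I × D) => K.char p.1 (K.push p.2) :=
      continuous_sigma fun j => (K.char j).continuous.comp K.push.continuous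
    have h4 : Continuous fun p : I × (Σ _ : J, D) => (⟨p.2.1, p.1, p.2.2⟩ : Σ _ : J, I × D) := by
      have h5 : Continuous fun p : (Σ _ : J, D) × I => (⟨p.1.1, p.2, p.1.2⟩ : Σ _ : J, I × D) := by
        rw [← (Homeomorph.sigmaProdDistrib (X := fun _ : J => D) (Y := I)).symm.comp_continuous_iff']
        refine continuous_sigma fun j => ?_
        change Continuous fun q : D × I => (⟨j, q.2, q.1⟩ : Σ _ : J, I × D)
        exact continuous_sigmaMk.comp continuous_swap
      exact h5.comp continuous_swap
    exact h3.comp h4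
  have h6 : (fun p : I × (A ⊕ Σ _ : J, D) =>
      K.deform (p.1, Sum.elim K.incl (fun q : Σ _ : J, D => K.char q.1 q.2) p.2)) =
      Sum.elim (fun p : I × A => K.deform (p.1, K.incl p.2))
        (fun p : I × (Σ _ : J, D) => K.deform (p.1, K.char p.2.1 p.2.2)) ∘
        (Homeomorph.prodSumDistrib (X := I) (Y := A) (Z := Σ _ : J, D)) := by
    funext ⟨t, s⟩
    cases s <;> rfl
  rw [h6]
  exact (continuous_sumElim.2 ⟨h1, h2⟩).comp (Homeomorph.continuous _)

/-- The complement of the cores. -/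
def outer : Set X := {x | ∀ j, ∀ z ∈ K.core, x ≠ K.char j z}

theorem char_mem_outer {j : J} {z : D} : K.char j z ∈ K.outer ↔ z ∉ K.core := by
  refine ⟨fun h hz => h j z hz rfl, fun hz k w hw h => hz ?_⟩
  obtain ⟨-, rfl⟩ := K.char_eq (K.disjoint w hw) h.symm
  exact hw

theorem incl_mem_outer (a : A) : K.incl a ∈ K.outer :=
  fun _ z hz => K.incl_ne_char (K.disjoint z hz)

theorem isOpen_outer : IsOpen K.outer := by
  rw [K.isOpen_iff]
  constructor
  · convert isOpen_univ
    exact Set.eq_univ_of_forall K.incl_mem_outer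
  · intro j
    convert K.isClosed_core.isOpen_compl using 1
    ext z
    exact K.char_mem_outer

theorem exists_deform_one {x : X} (hx : x ∈ K.outer) : ∃ a, K.incl a = K.deform (1, x) := by
  rcases K.exists_eq x with ⟨a, rfl⟩ | ⟨j, z, -, rfl⟩
  · exact ⟨a, (K.deform_incl 1 a).symm⟩
  · refine ⟨K.att j ⟨_, K.push_one z (K.char_mem_outer.1 hx)⟩, ?_⟩
    rw [K.incl_att, K.deform_char]

/-- The retraction of the complement of the cores onto `A`. -/
def retract (x : K.outer) : A := (K.exists_deform_one x.2).choose

theorem incl_retract (x : K.outer) : K.incl (K.retract x) = K.deform (1, x) :=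
  (K.exists_deform_one x.2).choose_spec

theorem retract_incl (a : A) : K.retract ⟨K.incl a, K.incl_mem_outer a⟩ = a :=
  K.incl_injective (by rw [K.incl_retract, K.deform_incl])

theorem retract_char {j : J} {z : D} (hz : z ∉ K.core) :
    K.retract ⟨K.char j z, K.char_mem_outer.2 hz⟩ = K.att j ⟨_, K.push_one z hz⟩ :=
  K.incl_injective (by rw [K.incl_retract, K.deform_char, K.incl_att])

/-- That `incl` is injective and continuous does not transfer continuity of `deform` to `retract`.
Instead, the preimage of an open `O` is tested in the quotient topology: its trace on `A` is `O`,
and its trace on a cell is open in the complement of the core. -/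
theorem continuous_retract : Continuous K.retract := by
  refine continuous_def.2 fun O hO => ?_
  rw [K.isOpen_outer.isOpenEmbedding_subtypeVal.isOpen_iff_image_isOpen, K.isOpen_iff]
  constructor
  · convert hO
    ext a
    refine ⟨?_, fun ha => ⟨⟨K.incl a, K.incl_mem_outer a⟩, ?_, rfl⟩⟩
    · rintro ⟨x, hx, hxa⟩
      obtain rfl : x = ⟨K.incl a, K.incl_mem_outer a⟩ := Subtype.ext hxa
      rwa [Set.mem_preimage, K.retract_incl] at hx
    · rwa [Set.mem_preimage, K.retract_incl]
  · intro j
    have hc : Continuous fun z : (K.coreᶜ : Set D) =>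
        K.att j ⟨K.push (1, z), K.push_one z z.2⟩ := by fun_prop
    convert K.isClosed_core.isOpen_compl.isOpenEmbedding_subtypeVal.isOpenMap _
      (hO.preimage hc) using 1
    ext z
    constructor
    · rintro ⟨x, hx, hxz⟩
      have hz : z ∉ K.core := by
        rw [← K.char_mem_outer (j := j), ← hxz]
        exact x.2
      obtain rfl : x = ⟨K.char j z, K.char_mem_outer.2 hz⟩ := Subtype.ext hxz
      rw [Set.mem_preimage, K.retract_char hz] at hx
      exact ⟨⟨z, hz⟩, hx, rfl⟩
    · rintro ⟨⟨z, hz⟩, hx, rfl⟩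
      refine ⟨⟨K.char j z, K.char_mem_outer.2 hz⟩, ?_, rfl⟩
      rwa [Set.mem_preimage, K.retract_char hz]

/-- The open cell of `j`. -/
def openCell (j : J) : Set X := K.char j '' K.bdryᶜ

/-- Such an image misses `A` and all other cells. Hence a characteristic map is an open embedding on
its open cell, and paths in the open cell lift. -/
theorem isOpen_char_image (j : J) {W : Set D} (hW : IsOpen W) (hb : ∀ z ∈ W, z ∉ K.bdry) :
    IsOpen (K.char j '' W) := by
  rw [K.isOpen_iff]
  constructor
  · convert isOpen_empty
    refine Set.eq_empty_of_forall_notMem ?_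
    rintro a ⟨z, hz, h⟩
    exact K.incl_ne_char (hb z hz) h.symm
  · intro k
    by_cases hk : j = k
    · subst hk
      convert hW
      ext w
      refine ⟨?_, fun hw => ⟨w, hw, rfl⟩⟩
      rintro ⟨z, hz, h⟩
      obtain ⟨-, rfl⟩ := K.char_eq (hb z hz) h
      exact hz
    · convert isOpen_empty
      refine Set.eq_empty_of_forall_notMem ?_
      rintro w ⟨z, hz, h⟩
      exact hk (K.char_eq (hb z hz) h).1

theorem isOpen_openCell (j : J) : IsOpen (K.openCell j) :=
  K.isOpen_char_image j K.isClosed_bdry.isOpen_compl fun _ h => h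

theorem exists_lift_openCell {j : J} {x y : X} (p : Path x y) (hp : ∀ t, p t ∈ K.openCell j) :
    ∃ (z w : D) (q : Path z w), ∀ t, K.char j (q t) = p t := by
  choose f hf hfp using hp
  have hc : Continuous f := by
    refine continuous_def.2 fun W hW => ?_
    convert (K.isOpen_char_image j (hW.inter K.isClosed_bdry.isOpen_compl)
      fun z hz => hz.2).preimage p.continuous using 1
    ext t
    refine ⟨fun ht => ⟨f t, ⟨ht, hf t⟩, hfp t⟩, ?_⟩
    rintro ⟨z, ⟨hz, hzb⟩, h⟩
    obtain ⟨-, rfl⟩ := K.char_eq hzb (h.trans (hfp t).symm)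
    exact hz
  exact ⟨f 0, f 1, ⟨⟨f, hc⟩, rfl, rfl⟩, hfp⟩

/-- A path system that contains the paths of `A` and of the cells contains all paths. -/
theorem mem_pathSystem (S : PathSystem X) (hA : ∀ {a b : A} (p : Path a b), (S.comap K.incl).Mem p)
    (hD : ∀ (j : J) {z w : D} (p : Path z w), (S.comap (K.char j)).Mem p) {x y : X}
    (p : Path x y) : S.Mem p := by
  -- The track of a point under the deformation is constant if the point lies in `A`, and otherwise
  -- stays inside one cell.
  have htrack : ∀ (x : X) (q : Path x (K.deform (1, x))), (∀ t, q t = K.deform (t, x)) →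
      S.Mem q := by
    intro x q hq
    rcases K.exists_eq x with ⟨a, rfl⟩ | ⟨j, z, -, rfl⟩
    · exact S.of_const fun t => by rw [hq, K.deform_incl]
    · let r : Path z (K.push (1, z)) :=
        ⟨⟨fun t => K.push (t, z), by fun_prop⟩, K.push_zero z, rfl⟩
      exact S.of_eq (fun t => by rw [hq, K.deform_char]; rfl) (hD j r)
  have hdeform0 : ∀ x, K.deform (0, x) = x := by
    intro x
    rcases K.exists_eq x with ⟨a, rfl⟩ | ⟨j, z, -, rfl⟩
    · rw [K.deform_incl]
    · rw [K.deform_char, K.push_zero]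
  have hdc := K.continuous_deform
  -- The cover consists of the complement of the cores (`none`) and the open cells (`some j`).
  refine S.of_locally p (fun i : Option J => i.elim K.outer K.openCell) ?_ ?_ ?_
  · rintro (_ | j)
    · exact K.isOpen_outer
    · exact K.isOpen_openCell j
  · intro t
    by_cases h : p t ∈ K.outer
    · exact ⟨none, h⟩
    · simp only [outer, ne_eq, Set.mem_ofPred_eq, not_forall, not_not] at h
      obtain ⟨j, z, hz, h⟩ := h
      exact ⟨some j, z, K.disjoint z hz, h.symm⟩
  · rintro (_ | j) x' y' q hq
    -- The deformation sweeps a square out of `q`. Two of its sides are tracks of the end points,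
    -- and its far side is the image of a path in `A`.
    · let F : C(I × I, X) := ⟨fun s => K.deform (s.1, q s.2), by fun_prop⟩
      let l : Path x' (K.deform (1, x')) :=
        ⟨⟨fun t => K.deform (t, x'), by fun_prop⟩, hdeform0 x', rfl⟩
      let r : Path y' (K.deform (1, y')) :=
        ⟨⟨fun t => K.deform (t, y'), by fun_prop⟩, hdeform0 y', rfl⟩
      let t : Path (K.deform (1, x')) (K.deform (1, y')) :=
        ⟨⟨fun s => K.deform (1, q s), by fun_prop⟩, by simp, by simp⟩
      refine S.of_square F (l := l) (r := r) (t := t) (fun s => hdeform0 _) (fun s => rfl)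
        (fun s => by simp [F, l]) (fun s => by simp [F, r]) (htrack _ l fun _ => rfl)
        (htrack _ r fun _ => rfl) ?_
      let f : I → A := fun s => K.retract ⟨q s, hq s⟩
      have hf : Continuous f := K.continuous_retract.comp (by fun_prop)
      let a : Path (f 0) (f 1) := ⟨⟨f, hf⟩, rfl, rfl⟩
      exact S.of_eq (fun s => K.incl_retract ⟨q s, hq s⟩) (hA a)
    · obtain ⟨z, w, r, hr⟩ := K.exists_lift_openCell q hq
      exact S.of_eq hr (hD j r)

end CellAttachment

end
noncomputable section

open unitInterval

namespace TwoComplex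

variable {V E F : Type*} (K : TwoComplex V E F) (Y : Set V)

/-! ### The quotient by the ghost vertices as a CW complex -/

/-- The vertices of `Σ/Y`, with the discrete topology. -/
def GhostVertex (Y : Set V) : Type _ := Quot fun v w : V => v ∈ Y ∧ w ∈ Y

/-- The image of a vertex in `Σ/Y`. -/
def GhostVertex.mk (v : V) : GhostVertex Y := Quot.mk _ v

instance : TopologicalSpace (GhostVertex Y) := ⊥

instance : DiscreteTopology (GhostVertex Y) := ⟨rfl⟩

/-- The 1-skeleton of `Σ/Y`. -/
def GhostSkeleton : Type _ :=
  Quot fun x z : K.Skeleton => x ∈ K.skeletonPt '' Y ∧ z ∈ K.skeletonPt '' Y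

instance : TopologicalSpace (K.GhostSkeleton Y) :=
  inferInstanceAs (TopologicalSpace
    (Quot fun x z : K.Skeleton => x ∈ K.skeletonPt '' Y ∧ z ∈ K.skeletonPt '' Y))

/-- The quotient map from the 1-skeleton of `Σ` to that of `Σ/Y`. -/
def ghostSkeletonProj : C(K.Skeleton, K.GhostSkeleton Y) where
  toFun x := Quot.mk _ x
  continuous_toFun := continuous_quot_mk

/-- The map from the 1-skeleton of `Σ/Y` to `Σ/Y`. -/
def ghostSkeletonIncl : C(K.GhostSkeleton Y, K.GhostQuotient Y) where
  toFun := Quot.lift (fun x => K.ghostProj Y (K.skeletonIncl x)) (by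
    rintro _ _ ⟨⟨v, hv, rfl⟩, ⟨w, hw, rfl⟩⟩
    exact K.ghostProj_pt Y ⟨v, hv⟩ ⟨w, hw⟩)
  continuous_toFun := continuous_quot_lift _ (by fun_prop)

/-- The deformation of the unit interval that expands the middle half. -/
def intervalPush : C(I × I, I) where
  -- At time `1` the point `s` goes to `2 s - 1/2`, clamped to `[0,1]`. Everything outside `[1/4,
  -- 3/4]` reaches an end point, which dictates the core below.
  toFun p := Set.Icc.convexComb p.2 (Set.projIcc 0 1 zero_le_one (2 * (p.2 : ℝ) - 1 / 2)) p.1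
  continuous_toFun := by
    have h : Continuous fun p : I × I =>
        Set.projIcc (0 : ℝ) 1 zero_le_one (2 * (p.2 : ℝ) - 1 / 2) :=
      continuous_projIcc.comp (by fun_prop)
    fun_prop

/-- The deformation of the disk that expands the disk of radius `1/2`. -/
def diskPush : C(I × Disk, Disk) where
  -- The linear homotopy from `z` to `z / max (1/2) ‖z‖`; the maximum avoids division by zero and
  -- puts all `z` with `‖z‖ > 1/2` on the circle.
  toFun p := ⟨((1 - (p.1 : ℝ) + p.1 * (max (1 / 2) ‖(p.2 : ℂ)‖)⁻¹ : ℝ) : ℂ) * p.2, by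
    have h0 := p.1.2.1
    have h1 := p.1.2.2
    have hz : ‖(p.2 : ℂ)‖ ≤ 1 := mem_closedBall_zero_iff.1 p.2.2
    have hm : (0 : ℝ) < max (1 / 2) ‖(p.2 : ℂ)‖ := lt_max_of_lt_left (by norm_num)
    have h2 : (max (1 / 2) ‖(p.2 : ℂ)‖)⁻¹ * ‖(p.2 : ℂ)‖ ≤ 1 := by
      rw [inv_mul_le_one₀ hm]
      exact le_max_right _ _
    rw [mem_closedBall_zero_iff, norm_mul, Complex.norm_real, Real.norm_of_nonneg
      (add_nonneg (by linarith) (mul_nonneg h0 (inv_nonneg.2 hm.le)))]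
    nlinarith⟩
  continuous_toFun := by
    have h : ∀ p : I × Disk, max (1 / 2) ‖(p.2 : ℂ)‖ ≠ 0 := fun p =>
      (lt_max_of_lt_left (by norm_num)).ne'
    have h' : Continuous fun p : I × Disk => (max (1 / 2) ‖(p.2 : ℂ)‖)⁻¹ :=
      Continuous.inv₀ (by fun_prop) h
    fun_prop

/-- The characteristic map of a 1-cell of `Σ/Y`. -/
def ghostEdge (e : E) : C(I, K.GhostSkeleton Y) :=
  (K.ghostSkeletonProj Y).comp (K.skeletonEdge e).toContinuousMap

/-- The characteristic map of a 2-cell. -/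
def faceMap (f : F) : C(Disk, K.Realization) where
  toFun z := Quot.mk _ (.inr ⟨f, z⟩)
  continuous_toFun := continuous_quot_mk.comp (continuous_inr.comp continuous_sigmaMk)

theorem faceMap_diskBoundary (f : F) (t : I) :
    K.faceMap f (diskBoundary t) = K.path (K.boundary f) t :=
  Quot.sound (GlueTwo.attach f t)

/-- The inclusion of the vertices of `Σ/Y`. -/
def ghostVertexIncl : C(GhostVertex Y, K.GhostSkeleton Y) where
  toFun := Quot.lift (fun v => K.ghostSkeletonProj Y (K.skeletonPt v)) (by
    rintro v w ⟨hv, hw⟩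
    exact Quot.sound ⟨⟨v, hv, rfl⟩, ⟨w, hw, rfl⟩⟩)
  continuous_toFun := continuous_of_discreteTopology

open Classical in
/-- The 1-skeleton of `Σ/Y` is obtained from the vertices by attaching the edges. -/
def edgeAttachment : CellAttachment (GhostVertex Y) E I (K.GhostSkeleton Y) where
  incl := K.ghostVertexIncl Y
  char := K.ghostEdge Y
  bdry := {0, 1}
  core := {s | 1 / 4 ≤ (s : ℝ) ∧ (s : ℝ) ≤ 3 / 4}
  isClosed_bdry := (Set.toFinite _).isClosed
  isClosed_core := (isClosed_le continuous_const continuous_subtype_val).inter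
    (isClosed_le continuous_subtype_val continuous_const)
  disjoint := by
    rintro z ⟨h1, h2⟩ (rfl | rfl)
    · norm_num at h1
    · norm_num at h2
  att e := ⟨fun z => if (z : I) = 0 then Quot.mk _ (K.src e) else Quot.mk _ (K.tgt e),
    continuous_of_discreteTopology⟩
  incl_att := by
    rintro e ⟨z, rfl | rfl⟩
    · simp only [ContinuousMap.coe_mk]
      exact congrArg (K.ghostSkeletonProj Y) (K.skeletonEdge e).source.symm
    · simp only [ContinuousMap.coe_mk, one_ne_zero]
      exact congrArg (K.ghostSkeletonProj Y) (K.skeletonEdge e).target.symm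
  push := intervalPush
  push_zero z := by simp [intervalPush]
  push_bdry := by
    rintro t z (rfl | rfl)
    · simp only [intervalPush, ContinuousMap.coe_mk]
      rw [Set.projIcc_of_le_left _ (by norm_num)]
      exact Subtype.ext (by simp)
    · simp only [intervalPush, ContinuousMap.coe_mk]
      rw [Set.projIcc_of_right_le _ (by norm_num)]
      exact Subtype.ext (by simp)
  push_one z hz := by
    simp only [intervalPush, ContinuousMap.coe_mk, Set.Icc.convexComb_one]
    rw [Set.mem_ofPred_eq, not_and_or, not_le, not_le] at hz
    rcases hz with hz | hz
    · exact Or.inl (Set.projIcc_of_le_left _ (by linarith))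
    · exact Or.inr (Set.projIcc_of_right_le _ (by linarith))
  isQuotientMap := by
    have h : Topology.IsQuotientMap fun x : (Σ _ : V, PUnit.{1}) ⊕ (Σ _ : E, I) =>
        K.ghostSkeletonProj Y (Quot.mk K.GlueOne x) :=
      isQuotientMap_quot_mk.comp isQuotientMap_quot_mk
    -- Gluing first and then identifying `Y` is a quotient map. It factors through identifying the
    -- vertices beforehand, so the second factor is a quotient map too.
    refine Topology.IsQuotientMap.of_comp 
      (f := Sum.map (fun v : Σ _ : V, PUnit.{1} => GhostVertex.mk Y v.1) id)
      (g := Sum.elim (K.ghostVertexIncl Y) fun p : Σ _ : E, I => K.ghostEdge Y p.1 p.2)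
      ?_ ?_ ?_
    · exact (continuous_sigma fun v => continuous_of_discreteTopology).sumMap continuous_id
    · refine continuous_sumElim.2 ⟨ContinuousMap.continuous _, continuous_sigma fun e => ?_⟩
      exact (K.ghostEdge Y e).continuous
    · convert h using 1
      funext x
      rcases x with v | e <;> rfl
  -- End points of an edge count as vertices; this makes the value compatible with both
  -- identifications.
  normal := Quot.lift (Quot.lift (Sum.elim (fun v => .inl (Quot.mk _ v.1)) fun p =>
      if p.2 = 0 then .inl (Quot.mk _ (K.src p.1)) else
      if p.2 = 1 then .inl (Quot.mk _ (K.tgt p.1)) else .inr p) (by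
        rintro _ _ (e | e) <;> simp)) (by
      rintro _ _ ⟨⟨v, hv, rfl⟩, ⟨w, hw, rfl⟩⟩
      exact congrArg Sum.inl (Quot.sound ⟨hv, hw⟩))
  normal_incl := by
    rintro ⟨v⟩
    rfl
  normal_char e z hz := by
    rw [Set.mem_insert_iff, Set.mem_singleton_iff, not_or] at hz
    change (if z = 0 then _ else if z = 1 then _ else _) = _
    rw [if_neg hz.1, if_neg hz.2]

/-- The attaching map of a 2-cell of `Σ/Y`. -/
def ghostAttach (f : F) : C(diskSphere, K.GhostSkeleton Y) :=
  (exists_sphere_lift ((K.ghostSkeletonProj Y).comp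
    (K.skeletonPath (K.boundary f)).toContinuousMap) (by simp)).choose

theorem ghostAttach_diskBoundary (f : F) (t : I) :
    K.ghostAttach Y f ⟨diskBoundary t, norm_diskBoundary t⟩ =
      K.ghostSkeletonProj Y (K.skeletonPath (K.boundary f) t) :=
  (exists_sphere_lift ((K.ghostSkeletonProj Y).comp
    (K.skeletonPath (K.boundary f)).toContinuousMap) (by simp)).choose_spec t

open Classical in
/-- `Σ/Y` is obtained from its 1-skeleton by attaching the faces. -/
def faceAttachment : CellAttachment (K.GhostSkeleton Y) F Disk (K.GhostQuotient Y) where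
  incl := K.ghostSkeletonIncl Y
  char f := (K.ghostProj Y).comp (K.faceMap f)
  bdry := diskSphere
  core := {z | ‖(z : ℂ)‖ ≤ 1 / 2}
  isClosed_bdry := isClosed_eq (by fun_prop) continuous_const
  isClosed_core := isClosed_le (by fun_prop) continuous_const
  disjoint z hz hz' := by
    simp only [diskSphere, Set.mem_ofPred_eq] at hz hz'
    norm_num [hz'] at hz
  att := K.ghostAttach Y
  incl_att := by
    rintro f ⟨z, hz⟩
    obtain ⟨t, rfl⟩ := exists_diskBoundary_eq hz
    rw [ghostAttach_diskBoundary]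
    exact congrArg (K.ghostProj Y) (K.faceMap_diskBoundary f t).symm
  push := diskPush
  push_zero z := Subtype.ext (by simp [diskPush])
  push_bdry t z hz := by
    have hz : ‖(z : ℂ)‖ = 1 := hz
    have : max (1 / 2 : ℝ) 1 = 1 := by norm_num
    exact Subtype.ext (by simp only [diskPush, ContinuousMap.coe_mk, hz, this]; simp)
  push_one z hz := by
    have hz : 1 / 2 < ‖(z : ℂ)‖ := not_le.1 hz
    have h0 : ‖(z : ℂ)‖ ≠ 0 := by linarith
    simp only [diskPush, diskSphere, ContinuousMap.coe_mk, max_eq_right hz.le, Set.mem_ofPred_eq]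
    rw [norm_mul, Complex.norm_real]
    simp [h0]
  isQuotientMap := by
    have h : Topology.IsQuotientMap fun x : K.Skeleton ⊕ (Σ _ : F, Disk) =>
        K.ghostProj Y (Quot.mk K.GlueTwo x) :=
      isQuotientMap_quot_mk.comp isQuotientMap_quot_mk
    refine Topology.IsQuotientMap.of_comp (f := Sum.map (K.ghostSkeletonProj Y) id) ?_ ?_ ?_
    · exact (K.ghostSkeletonProj Y).continuous.sumMap continuous_id
    · refine continuous_sumElim.2 ⟨ContinuousMap.continuous _, continuous_sigma fun f => ?_⟩
      exact ((K.ghostProj Y).comp (K.faceMap f)).continuous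
    · convert h using 1
      funext x
      rcases x with v | e <;> rfl
  normal := Quot.lift (Quot.lift (Sum.elim (fun x => .inl (K.ghostSkeletonProj Y x)) fun p =>
      if h : p.2 ∈ diskSphere then .inl (K.ghostAttach Y p.1 ⟨p.2, h⟩) else .inr p) (by
        rintro _ _ ⟨f, t⟩
        rw [Sum.elim_inl, Sum.elim_inr,
          dif_pos (show (⟨f, diskBoundary t⟩ : Σ _ : F, Disk).2 ∈ diskSphere from
            norm_diskBoundary t), ghostAttach_diskBoundary]))
      (by
        rintro _ _ ⟨⟨v, hv, rfl⟩, ⟨w, hw, rfl⟩⟩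
        exact congrArg Sum.inl (Quot.sound ⟨⟨v, hv, rfl⟩, ⟨w, hw, rfl⟩⟩))
  normal_incl := by
    rintro ⟨x⟩
    rfl
  normal_char f z hz := by
    change (if h : z ∈ diskSphere then _ else _) = _
    rw [dif_neg hz]

end TwoComplex

end
noncomputable section

open unitInterval

/-! ### Edge paths -/

namespace EdgePath

variable {V E : Type*} {src tgt : E → V}

/-- Concatenation of edge paths. -/
def append : {u v w : V} → EdgePath src tgt u v → EdgePath src tgt v w → EdgePath src tgt u w
  | _, _, _, .nil _, q => q
  | _, _, _, .fwd e p, q => .fwd e (p.append q)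
  | _, _, _, .bwd e p, q => .bwd e (p.append q)

/-- The edge path along one edge. -/
def single (e : E) : EdgePath src tgt (src e) (tgt e) := .fwd e (.nil _)

/-- The edge path backwards along one edge. -/
def singleBwd (e : E) : EdgePath src tgt (tgt e) (src e) := .bwd e (.nil _)

/-- Reversal of edge paths. -/
def reverse : {u v : V} → EdgePath src tgt u v → EdgePath src tgt v u
  | _, _, .nil v => .nil v
  | _, _, .fwd e p => p.reverse.append (singleBwd e)
  | _, _, .bwd e p => p.reverse.append (single e)

theorem word_append {u v w : V} (p : EdgePath src tgt u v) (q : EdgePath src tgt v w) :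
    (p.append q).word = p.word ++ q.word := by
  induction p with
  | nil => rfl
  | fwd e p ih => simp [append, word, ih]
  | bwd e p ih => simp [append, word, ih]

end EdgePath

namespace GroupCSS

variable {V E G : Type*} {src tgt : E → V} [Group G] (g : E → G)

theorem evalWord_append {u v w : V} (p : EdgePath src tgt u v) (q : EdgePath src tgt v w) :
    evalWord g (p.append q).word = evalWord g p.word * evalWord g q.word := by
  rw [EdgePath.word_append, evalWord, List.map_append, List.prod_append]
  rfl

theorem evalWord_nil (v : V) : evalWord g (EdgePath.nil (src := src) (tgt := tgt) v).word = 1 :=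
  rfl

theorem evalWord_fwd (e : E) {w : V} (p : EdgePath src tgt (tgt e) w) :
    evalWord g (EdgePath.fwd e p).word = g e * evalWord g p.word := by
  simp [EdgePath.word, evalWord]

theorem evalWord_bwd (e : E) {w : V} (p : EdgePath src tgt (src e) w) :
    evalWord g (EdgePath.bwd e p).word = (g e)⁻¹ * evalWord g p.word := by
  simp [EdgePath.word, evalWord]

theorem evalWord_single (e : E) :
    evalWord g (EdgePath.single (src := src) (tgt := tgt) e).word = g e := by
  simp [EdgePath.single, EdgePath.word, evalWord]

theorem evalWord_reverse {u v : V} (p : EdgePath src tgt u v) :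
    evalWord g p.reverse.word = (evalWord g p.word)⁻¹ := by
  induction p with
  | nil => simp [EdgePath.reverse, evalWord, EdgePath.word]
  | fwd e p ih =>
    rw [EdgePath.reverse, evalWord_append, ih, evalWord_fwd, EdgePath.singleBwd, evalWord_bwd,
      evalWord_nil]
    group
  | bwd e p ih =>
    rw [EdgePath.reverse, evalWord_append, ih, evalWord_bwd, evalWord_single]
    group

end GroupCSS

/-! ### Homotopy classes of paths -/

namespace LoopGroup

variable {X : Type*} [TopologicalSpace X]

theorem mk_eq_mk_iff {x : X} {p q : Path x x} : mk p = mk q ↔ p.Homotopic q := by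
  rw [mk, mk, MulOpposite.op_inj]
  exact Path.Homotopic.Quotient.eq

theorem mk_refl (x : X) : mk (Path.refl x) = 1 := rfl

theorem mk_symm {x : X} (p : Path x x) : mk p.symm = (mk p)⁻¹ := rfl

theorem mk_surjective {x : X} : Function.Surjective (mk (x := x)) := by
  intro a
  obtain ⟨p, hp⟩ := Path.Homotopic.Quotient.mk_surjective (MulOpposite.unop a).toPath
  exact ⟨p, MulOpposite.unop_injective hp⟩

end LoopGroup

namespace Path.Homotopic.Quotient

variable {X : Type*} [TopologicalSpace X] {x y z : X}

theorem symm_trans_cancel (a : Path.Homotopic.Quotient x y) (b : Path.Homotopic.Quotient y z) :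
    a.symm.trans (a.trans b) = b := by
  rw [← trans_assoc, symm_trans, refl_trans]

theorem trans_symm_cancel (a : Path.Homotopic.Quotient y x) (b : Path.Homotopic.Quotient y z) :
    a.trans (a.symm.trans b) = b := by
  rw [← trans_assoc, trans_symm, refl_trans]

theorem symm_trans_rev (a : Path.Homotopic.Quotient x y) (b : Path.Homotopic.Quotient y z) :
    (a.trans b).symm = b.symm.trans a.symm := by
  have h : (a.trans b).symm.trans ((a.trans b).trans (b.symm.trans a.symm)) =
      b.symm.trans a.symm := symm_trans_cancel _ _
  rw [← h, trans_assoc, trans_symm_cancel, trans_symm, trans_refl]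

theorem symm_symm (a : Path.Homotopic.Quotient x y) : a.symm.symm = a := by
  induction a using Path.Homotopic.Quotient.ind with
  | mk p => rw [← mk_symm, ← mk_symm, Path.symm_symm]

end Path.Homotopic.Quotient

namespace TwoComplex

variable {V E F : Type*} (K : TwoComplex V E F)

theorem skeletonPath_append {u v w : V} (p : K.Walk u v) (q : K.Walk v w) :
    (K.skeletonPath (p.append q)).Homotopic ((K.skeletonPath p).trans (K.skeletonPath q)) := by
  induction p with
  | nil v => exact ⟨(Path.Homotopy.reflTrans _).symm⟩
  | fwd e p ih =>
    exact (Path.Homotopic.hcomp (Path.Homotopic.refl _) (ih q)).trans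
      ⟨(Path.Homotopy.transAssoc _ _ _).symm⟩
  | bwd e p ih =>
    exact (Path.Homotopic.hcomp (Path.Homotopic.refl _) (ih q)).trans
      ⟨(Path.Homotopy.transAssoc _ _ _).symm⟩

theorem path_append {u v w : V} (p : K.Walk u v) (q : K.Walk v w) :
    (K.path (p.append q)).Homotopic ((K.path p).trans (K.path q)) := by
  have := (K.skeletonPath_append p q).map K.skeletonIncl
  rwa [Path.map_trans] at this

/-- The path in `Σ` along an edge. -/
def edgePath (e : E) : Path (K.pt (K.src e)) (K.pt (K.tgt e)) :=
  (K.skeletonEdge e).map K.skeletonIncl.continuous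

theorem path_single (e : E) : (K.path (EdgePath.single e)).Homotopic (K.edgePath e) :=
  Path.Homotopic.map ⟨Path.Homotopy.transRefl _⟩ _

/-- The boundary of a face is null-homotopic. -/
theorem path_boundary (f : F) : (K.path (K.boundary f)).Homotopic (Path.refl _) := by
  -- The boundary path is the image of the boundary circle, which is null-homotopic in the
  -- contractible disk.
  let l : Path (diskBoundary 0) (diskBoundary 0) :=
    ⟨⟨diskBoundary, continuous_diskBoundary⟩, rfl, diskBoundary_zero.symm⟩
  have h := (SimplyConnectedSpace.paths_homotopic l (Path.refl _)).map (K.faceMap f)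
  have h0 : K.pt (K.base f) = K.faceMap f (diskBoundary 0) := by
    rw [faceMap_diskBoundary, Path.source]
  have h1 : K.path (K.boundary f) = (l.map (K.faceMap f).continuous).cast h0 h0 :=
    Path.ext (funext fun t => (K.faceMap_diskBoundary f t).symm)
  have h2 : Path.refl (K.pt (K.base f)) =
      ((Path.refl (diskBoundary 0)).map (K.faceMap f).continuous).cast h0 h0 :=
    Path.ext (funext fun t => h0)
  rw [h1, h2]
  exact h.pathCast h0 h0

section Ghost

variable (Y : Set V) (y₁ : Y)

/-- The base point of `Σ/Y`. -/
abbrev ghostBase : K.GhostQuotient Y := K.ghostProj Y (K.pt y₁)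

/-- The class in `π₁(Σ/Y)` of an edge path between ghost vertices. -/
abbrev ghostClass {a b : Y} (p : K.Walk a b) : LoopGroup (K.GhostQuotient Y) (K.ghostBase Y y₁) :=
  LoopGroup.mk (K.ghostLoop Y y₁ p)

theorem ghostClass_eq_of_homotopic {a b : Y} {p q : K.Walk a b}
    (h : (K.path p).Homotopic (K.path q)) : K.ghostClass Y y₁ p = K.ghostClass Y y₁ q :=
  LoopGroup.mk_eq_mk_iff.2 ((h.map (K.ghostProj Y)).pathCast _ _)

theorem ghostClass_append {a b c : Y} (p : K.Walk a b) (q : K.Walk b c) :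
    K.ghostClass Y y₁ (p.append q) = K.ghostClass Y y₁ p * K.ghostClass Y y₁ q := by
  rw [ghostClass, ghostClass, ghostClass, LoopGroup.mk_mul_mk, LoopGroup.mk_eq_mk_iff]
  have h := ((K.path_append p q).map (K.ghostProj Y)).pathCast
    (K.ghostProj_pt Y y₁ a) (K.ghostProj_pt Y y₁ c)
  rw [Path.map_trans] at h
  exact h

theorem ghostClass_nil (a : Y) : K.ghostClass Y y₁ (EdgePath.nil (a : V)) = 1 := by
  rw [← LoopGroup.mk_refl, ghostClass, LoopGroup.mk_eq_mk_iff]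
  have h : K.ghostLoop Y y₁ (EdgePath.nil (a : V)) = Path.refl _ :=
    Path.ext (funext fun t => K.ghostProj_pt Y a y₁)
  rw [h]

end Ghost

theorem path_fwd {w : V} (e : E) (p : K.Walk (K.tgt e) w) :
    K.path (.fwd e p) = (K.edgePath e).trans (K.path p) :=
  Path.map_trans _ _ _

theorem path_bwd {w : V} (e : E) (p : K.Walk (K.src e) w) :
    K.path (.bwd e p) =
      (K.edgePath e).symm.trans (K.path p) :=
  Path.map_trans _ _ _

theorem path_reverse {u v : V} (p : K.Walk u v) :
    (K.path p.reverse).Homotopic (K.path p).symm := by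
  induction p with
  | nil v => exact Path.Homotopic.refl _
  | fwd e p ih =>
    refine (K.path_append p.reverse (.bwd e (.nil _))).trans ?_
    rw [K.path_fwd, K.path_bwd, ← Path.Homotopic.Quotient.eq]
    rw [← Path.Homotopic.Quotient.eq] at ih
    simp only [Path.Homotopic.Quotient.mk_trans, Path.Homotopic.Quotient.mk_symm, ih,
      Path.Homotopic.Quotient.symm_trans_rev]
    congr 1
    exact Path.Homotopic.Quotient.trans_refl _
  | bwd e p ih =>
    refine (K.path_append p.reverse (.fwd e (.nil _))).trans ?_
    rw [K.path_bwd, K.path_fwd, ← Path.Homotopic.Quotient.eq]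
    rw [← Path.Homotopic.Quotient.eq] at ih
    simp only [Path.Homotopic.Quotient.mk_trans, Path.Homotopic.Quotient.mk_symm, ih,
      Path.Homotopic.Quotient.symm_trans_rev, Path.Homotopic.Quotient.symm_symm]
    congr 1
    exact Path.Homotopic.Quotient.trans_refl _

theorem path_append_reverse {u v : V} (p : K.Walk u v) :
    (K.path (p.append p.reverse)).Homotopic (Path.refl _) := by
  refine (K.path_append p p.reverse).trans ?_
  exact (Path.Homotopic.hcomp (Path.Homotopic.refl _) (K.path_reverse p)).trans
    ⟨(Path.Homotopy.reflTransSymm _).symm⟩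

theorem ghostClass_reverse (Y : Set V) (y₁ : Y) {a b : Y} (p : K.Walk a b) :
    K.ghostClass Y y₁ p.reverse = (K.ghostClass Y y₁ p)⁻¹ := by
  rw [eq_comm, inv_eq_iff_mul_eq_one, ← K.ghostClass_append Y y₁ p p.reverse,
    ← K.ghostClass_nil Y y₁ a]
  exact K.ghostClass_eq_of_homotopic Y y₁ (K.path_append_reverse p)

/-! ### Connectedness -/

theorem reachable_eq_of_walk {u v : V} (p : K.Walk u v) :
    {w | Nonempty (K.Walk u w)} = {w | Nonempty (K.Walk v w)} :=
  Set.ext fun _ => ⟨fun ⟨q⟩ => ⟨p.reverse.append q⟩, fun ⟨q⟩ => ⟨p.append q⟩⟩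

/-- Any two vertices of a connected complex are joined by an edge path. -/
theorem nonempty_walk [ConnectedSpace K.Realization] (u v : V) : Nonempty (K.Walk u v) := by
  -- Each cell is sent to the set of vertices reachable from one of its vertices. This is a
  -- continuous map to a discrete space, hence constant on a connected space.
  let _ : TopologicalSpace (Set V) := ⊥
  have _ : DiscreteTopology (Set V) := ⟨rfl⟩
  let c : V → Set V := fun v => {w | Nonempty (K.Walk v w)}
  let s : C(K.Skeleton, Set V) :=
    ⟨Quot.lift (Sum.elim (fun p => c p.1) fun p => c (K.src p.1)) (by
      rintro _ _ (e | e)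
      · rfl
      · exact K.reachable_eq_of_walk (EdgePath.single e)),
      continuous_quot_lift _ (continuous_sumElim.2 ⟨continuous_sigma fun v => continuous_const (y := c v),
        continuous_sigma fun e => continuous_const (y := c (K.src e))⟩)⟩
  have hs : ∀ {a b : V} (p : K.Walk a b) (t : I), s (K.skeletonPath p t) = c a := by
    intro a b p t
    have h := PreconnectedSpace.constant inferInstance
      (s.continuous.comp (K.skeletonPath p).continuous) (x := t) (y := 0)
    refine h.trans ?_
    rw [Function.comp_apply, Path.source]
    rfl
  let r : K.Realization → Set V :=
    Quot.lift (Sum.elim s fun p => c (K.base p.1)) (by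
      rintro _ _ ⟨f, t⟩
      exact (hs _ t).symm)
  have hr : Continuous r := continuous_quot_lift _
    (continuous_sumElim.2 ⟨s.continuous, continuous_sigma fun f => continuous_const (y := c (K.base f))⟩)
  have h : c u = c v := PreconnectedSpace.constant inferInstance hr (x := K.pt u) (y := K.pt v)
  have hv : v ∈ c v := ⟨.nil v⟩
  rw [← h] at hv
  exact hv

end TwoComplex

end
noncomputable section

open unitInterval

/-! ### Generation of the fundamental group by edge paths -/

namespace LoopGroup

variable {X : Type*} [TopologicalSpace X] {b : X} (N : Subgroup (LoopGroup X b))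

/-- Two paths from the base point to the same point that differ by an element of `N`. -/
def Rel {x y : X} (r : Path b x) (s : Path b y) : Prop :=
  ∃ h : x = y, mk (r.trans (s.cast rfl h).symm) ∈ N

variable {N}

theorem rel_of_homotopic {x : X} {r s : Path b x} (h : r.Homotopic s) : Rel N r s := by
  refine ⟨rfl, ?_⟩
  rw [Path.cast_rfl_rfl]
  convert N.one_mem
  rw [← mk_refl, mk_eq_mk_iff]
  exact (h.hcomp (Path.Homotopic.refl _)).trans ⟨(Path.Homotopy.reflTransSymm _).symm⟩

theorem rel_of_eq {x y : X} {r : Path b x} {s : Path b y} (h : ∀ t, r t = s t) : Rel N r s := by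
  obtain rfl : x = y := by simpa using h 1
  obtain rfl : r = s := Path.ext (funext h)
  exact rel_of_homotopic (Path.Homotopic.refl _)

theorem Rel.symm {x y : X} {r : Path b x} {s : Path b y} (h : Rel N r s) : Rel N s r := by
  obtain ⟨rfl, h⟩ := h
  refine ⟨rfl, ?_⟩
  rw [Path.cast_rfl_rfl] at h ⊢
  rw [← N.inv_mem_iff, ← mk_symm, Path.trans_symm, Path.symm_symm]
  exact h

theorem Rel.trans {x y z : X} {r : Path b x} {s : Path b y} {t : Path b z} (h : Rel N r s)
    (h' : Rel N s t) : Rel N r t := by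
  obtain ⟨rfl, h⟩ := h
  obtain ⟨rfl, h'⟩ := h'
  refine ⟨rfl, ?_⟩
  rw [Path.cast_rfl_rfl] at h h' ⊢
  convert N.mul_mem h h' using 1
  rw [mk_mul_mk, mk_eq_mk_iff, ← Path.Homotopic.Quotient.eq]
  simp only [Path.Homotopic.Quotient.mk_trans, Path.Homotopic.Quotient.mk_symm,
    Path.Homotopic.Quotient.trans_assoc, Path.Homotopic.Quotient.symm_trans_cancel]

theorem Rel.append {x y z z' : X} {r : Path b x} {s : Path b y} (h : Rel N r s)
    {p : Path x z} {q : Path y z'} (hpq : ∀ t, p t = q t) : Rel N (r.trans p) (s.trans q) := by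
  obtain ⟨rfl, h⟩ := h
  obtain rfl : z = z' := by simpa using hpq 1
  obtain rfl : p = q := Path.ext (funext hpq)
  refine ⟨rfl, ?_⟩
  rw [Path.cast_rfl_rfl] at h ⊢
  convert h using 1
  rw [mk_eq_mk_iff, ← Path.Homotopic.Quotient.eq]
  simp only [Path.Homotopic.Quotient.mk_trans, Path.Homotopic.Quotient.mk_symm,
    Path.Homotopic.Quotient.trans_assoc, Path.Homotopic.Quotient.symm_trans_rev,
    Path.Homotopic.Quotient.trans_symm_cancel]

theorem mk_mem_of_rel {p : Path b b} (h : Rel N p (Path.refl b)) : mk p ∈ N := by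
  obtain ⟨h', h⟩ := h
  convert h using 1
  rw [mk_eq_mk_iff]
  exact ⟨(Path.Homotopy.transRefl p).symm⟩

theorem trans_map_homotopic {D : Type*} [TopologicalSpace D] (f : C(D, X)) {x : X}
    (r : Path b x) {z z' z'' : D} (q : Path z z') (p : Path z' z'') (h : x = f z) :
    ((r.trans ((q.map f.continuous).cast h rfl)).trans (p.map f.continuous)).Homotopic
      (r.trans (((q.trans p).map f.continuous).cast h rfl)) := by
  subst h
  rw [Path.map_trans]
  exact ⟨Path.Homotopy.transAssoc _ _ _⟩

theorem rel_refl_of_mem {x : X} (h : x = b) {p : Path b x} (hp : mk (p.cast rfl h.symm) ∈ N) :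
    Rel N p (Path.refl b) := by
  subst h
  refine ⟨rfl, ?_⟩
  convert hp using 1
  rw [mk_eq_mk_iff]
  exact ⟨Path.Homotopy.transRefl p⟩

variable (N) in
/-- The paths that belong to `N` when they are closed up by chosen paths from the base point. -/
def pathSystem (c : ∀ x, Path b x) : PathSystem X where
  Mem {x y} p := Rel N ((c x).trans p) (c y)
  refl x := rel_of_homotopic ⟨Path.Homotopy.transRefl _⟩
  symm {x y p} h := by
    refine (h.symm.append (p := p.symm) (q := p.symm) fun _ => rfl).trans (rel_of_homotopic ?_)
    rw [← Path.Homotopic.Quotient.eq]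
    simp only [Path.Homotopic.Quotient.mk_trans, Path.Homotopic.Quotient.mk_symm,
      Path.Homotopic.Quotient.trans_assoc, Path.Homotopic.Quotient.trans_symm,
      Path.Homotopic.Quotient.trans_refl]
  trans {x y z p q} hp hq := by
    refine (rel_of_homotopic ⟨(Path.Homotopy.transAssoc _ _ _).symm⟩).trans (.trans ?_ hq)
    exact hp.append fun _ => rfl
  homotopic h hp := (rel_of_homotopic ((Path.Homotopic.refl _).hcomp h.symm)).trans hp

end LoopGroup

namespace TwoComplex

variable {V E F : Type*} (K : TwoComplex V E F) (Y : Set V) (y₁ : Y)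

open LoopGroup

/-- The generating relation is symmetric and transitive, so passing to the quotient adds no more
than equality. -/
theorem GhostVertex.mk_eq_mk {v w : V} (h : GhostVertex.mk Y v = GhostVertex.mk Y w) :
    v = w ∨ v ∈ Y ∧ w ∈ Y := by
  let f : GhostVertex Y → Prop := Quot.lift (fun w => v = w ∨ v ∈ Y ∧ w ∈ Y) (by
    rintro a b ⟨ha, hb⟩
    refine propext ⟨?_, ?_⟩
    · rintro (rfl | h)
      · exact Or.inr ⟨ha, hb⟩
      · exact Or.inr ⟨h.1, hb⟩
    · rintro (rfl | h)
      · exact Or.inr ⟨hb, ha⟩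
      · exact Or.inr ⟨h.1, ha⟩)
  have h' : f (GhostVertex.mk Y v) := Or.inl rfl
  rw [h] at h'
  exact h'

/-- An edge path that starts at a ghost vertex, as a path in `Σ/Y`. -/
def ghostPath {a : Y} {v : V} (w : K.Walk a v) : Path (K.ghostBase Y y₁) (K.ghostProj Y (K.pt v)) :=
  ((K.path w).map (K.ghostProj Y).continuous).cast (K.ghostProj_pt Y y₁ a) rfl

/-- The subgroup generated by the edge paths between ghost vertices. -/
def ghostSubgroup : Subgroup (LoopGroup (K.GhostQuotient Y) (K.ghostBase Y y₁)) :=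
  Subgroup.closure {x | ∃ (a b : Y) (p : K.Walk a b), x = K.ghostClass Y y₁ p}

theorem ghostClass_mem {a b : Y} (p : K.Walk a b) :
    K.ghostClass Y y₁ p ∈ K.ghostSubgroup Y y₁ :=
  Subgroup.subset_closure ⟨a, b, p, rfl⟩

/-- If the end vertices agree, the difference of the two paths is an edge path between ghost
vertices. If both ends are ghost vertices, each path is already a generator. -/
theorem rel_ghostPath {a a' : Y} {v v' : V} (w : K.Walk a v) (w' : K.Walk a' v')
    (h : GhostVertex.mk Y v = GhostVertex.mk Y v') :
    Rel (K.ghostSubgroup Y y₁) (K.ghostPath Y y₁ w) (K.ghostPath Y y₁ w') := by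
  rcases GhostVertex.mk_eq_mk Y h with rfl | ⟨hv, hv'⟩
  · refine ⟨rfl, ?_⟩
    convert K.ghostClass_mem Y y₁ (w.append w'.reverse) using 1
    rw [mk_eq_mk_iff]
    have h1 : (K.path (w.append w'.reverse)).Homotopic ((K.path w).trans (K.path w').symm) :=
      (K.path_append _ _).trans ((Path.Homotopic.refl _).hcomp (K.path_reverse w'))
    have h2 := (h1.map (K.ghostProj Y)).pathCast
      (K.ghostProj_pt Y y₁ a) (K.ghostProj_pt Y y₁ a')
    rw [Path.map_trans] at h2
    exact h2.symm
  · refine (rel_refl_of_mem (K.ghostProj_pt Y ⟨v, hv⟩ y₁) ?_).trans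
      (rel_refl_of_mem (K.ghostProj_pt Y ⟨v', hv'⟩ y₁) ?_).symm
    · exact K.ghostClass_mem Y y₁ (b := ⟨v, hv⟩) w
    · exact K.ghostClass_mem Y y₁ (b := ⟨v', hv'⟩) w'

/-- The characteristic map of an edge in `Σ/Y`. -/
def edgeChar (e : E) : C(I, K.GhostQuotient Y) := (K.ghostSkeletonIncl Y).comp (K.ghostEdge Y e)

theorem edgeChar_zero (e : E) : K.edgeChar Y e 0 = K.ghostProj Y (K.pt (K.src e)) :=
  congrArg (fun x => K.ghostProj Y (K.skeletonIncl x)) (K.skeletonEdge e).source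

theorem edgeChar_one (e : E) : K.edgeChar Y e 1 = K.ghostProj Y (K.pt (K.tgt e)) :=
  congrArg (fun x => K.ghostProj Y (K.skeletonIncl x)) (K.skeletonEdge e).target

/-- The characteristic map of a face in `Σ/Y`. -/
def faceChar (f : F) : C(Disk, K.GhostQuotient Y) := (K.ghostProj Y).comp (K.faceMap f)

theorem faceChar_zero (f : F) :
    K.faceChar Y f (diskBoundary 0) = K.ghostProj Y (K.pt (K.base f)) := by
  rw [faceChar, ContinuousMap.comp_apply, faceMap_diskBoundary, Path.source]

/-- A path that runs from the base point to an edge and then along the edge. -/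
def edgeTail {a : Y} (e : E) (w : K.Walk a (K.src e)) {t : I} (q : Path 0 t) :
    Path (K.ghostBase Y y₁) (K.edgeChar Y e t) :=
  (K.ghostPath Y y₁ w).trans ((q.map (K.edgeChar Y e).continuous).cast
    (K.edgeChar_zero Y e).symm rfl)

/-- A path that runs from the base point to a face and then inside the face. -/
def faceTail {a : Y} (f : F) (w : K.Walk a (K.base f)) {z : Disk} (q : Path (diskBoundary 0) z) :
    Path (K.ghostBase Y y₁) (K.faceChar Y f z) :=
  (K.ghostPath Y y₁ w).trans ((q.map (K.faceChar Y f).continuous).cast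
    (K.faceChar_zero Y f).symm rfl)

/-- The standard paths from the base point. -/
inductive Based : ∀ {x : K.GhostQuotient Y}, Path (K.ghostBase Y y₁) x → Prop
  | vertex {a : Y} {v : V} (w : K.Walk a v) : Based (K.ghostPath Y y₁ w)
  | edge {a : Y} (e : E) (w : K.Walk a (K.src e)) {t : I} (q : Path 0 t)
      (ht : t ∉ (K.edgeAttachment Y).bdry) : Based (K.edgeTail Y y₁ e w q)
  | face {a : Y} (f : F) (w : K.Walk a (K.base f)) {z : Disk} (q : Path (diskBoundary 0) z)
      (hz : z ∉ (K.faceAttachment Y).bdry) : Based (K.faceTail Y y₁ f w q)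

variable {K Y y₁}

/-- A point lies in exactly one open cell of `Σ/Y`, so a standard path that ends at a vertex cannot
be of edge or face type. -/
theorem Based.rel_vertex {x : K.GhostQuotient Y} {r : Path (K.ghostBase Y y₁) x}
    (hr : K.Based Y y₁ r) {a : Y} {v : V} (w : K.Walk a v) (hx : x = K.ghostProj Y (K.pt v)) :
    Rel (K.ghostSubgroup Y y₁) r (K.ghostPath Y y₁ w) := by
  have hv : K.ghostProj Y (K.pt v) =
      (K.faceAttachment Y).incl ((K.edgeAttachment Y).incl (GhostVertex.mk Y v)) := rfl
  rw [hv] at hx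
  induction hr with
  | @vertex a' v' w' =>
    exact K.rel_ghostPath Y y₁ w' w
      ((K.edgeAttachment Y).incl_injective ((K.faceAttachment Y).incl_injective hx))
  | @edge a' e w' t q ht =>
    exact absurd ((K.faceAttachment Y).incl_injective hx).symm
      ((K.edgeAttachment Y).incl_ne_char (j := e) ht)
  | @face a' f w' z q hz =>
    exact absurd hx.symm ((K.faceAttachment Y).incl_ne_char (j := f) hz)

theorem rel_edgeTail {a a' : Y} {e : E} (w : K.Walk a (K.src e)) (w' : K.Walk a' (K.src e))
    {t : I} (q q' : Path 0 t) :
    Rel (K.ghostSubgroup Y y₁) (K.edgeTail Y y₁ e w q) (K.edgeTail Y y₁ e w' q') := by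
  refine ((K.rel_ghostPath Y y₁ w w' rfl).append fun _ => rfl).trans (rel_of_homotopic ?_)
  exact (Path.Homotopic.refl _).hcomp
    (((SimplyConnectedSpace.paths_homotopic q q').map _).pathCast _ _)

theorem rel_faceTail {a a' : Y} {f : F} (w : K.Walk a (K.base f)) (w' : K.Walk a' (K.base f))
    {z : Disk} (q q' : Path (diskBoundary 0) z) :
    Rel (K.ghostSubgroup Y y₁) (K.faceTail Y y₁ f w q) (K.faceTail Y y₁ f w' q') := by
  refine ((K.rel_ghostPath Y y₁ w w' rfl).append fun _ => rfl).trans (rel_of_homotopic ?_)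
  exact (Path.Homotopic.refl _).hcomp
    (((SimplyConnectedSpace.paths_homotopic q q').map _).pathCast _ _)

/-- At an end point of the edge the chosen path is of vertex type and must be compared by hand: with
`w` at `t = 0`, and with `w` continued along the whole edge at `t = 1`. -/
theorem Based.rel_edge {x : K.GhostQuotient Y} {r : Path (K.ghostBase Y y₁) x}
    (hr : K.Based Y y₁ r) {a : Y} {e : E} (w : K.Walk a (K.src e)) {t : I} (q : Path 0 t)
    (hx : x = K.edgeChar Y e t) :
    Rel (K.ghostSubgroup Y y₁) r (K.edgeTail Y y₁ e w q) := by
  by_cases h0 : t = 0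
  · subst h0
    refine (hr.rel_vertex w (hx.trans (K.edgeChar_zero Y e))).trans ?_
    refine Rel.trans ?_ (rel_edgeTail w w (Path.refl 0) q)
    refine (rel_of_homotopic ⟨(Path.Homotopy.transRefl _).symm⟩).trans
      (Rel.append (rel_of_homotopic (Path.Homotopic.refl _)) fun t => ?_)
    exact (K.edgeChar_zero Y e).symm
  by_cases h1 : t = 1
  · subst h1
    refine (hr.rel_vertex (w.append (.single e)) (hx.trans (K.edgeChar_one Y e))).trans ?_
    let i : Path (0 : I) 1 := ⟨⟨id, continuous_id⟩, rfl, rfl⟩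
    refine Rel.trans ?_ (rel_edgeTail w w i q)
    have h2 : (K.path (w.append (.single e))).Homotopic ((K.path w).trans (K.edgePath e)) :=
      (K.path_append _ _).trans ((Path.Homotopic.refl _).hcomp (K.path_single e))
    have h3 := (h2.map (K.ghostProj Y)).pathCast (K.ghostProj_pt Y y₁ a) rfl
    rw [Path.map_trans] at h3
    refine (rel_of_homotopic h3).trans ?_
    exact Rel.append (r := K.ghostPath Y y₁ w) (rel_of_homotopic (Path.Homotopic.refl _))
      (p := (K.edgePath e).map (K.ghostProj Y).continuous) fun t => rfl
  have ht : t ∉ (K.edgeAttachment Y).bdry := by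
    rintro (h | h)
    · exact h0 h
    · exact h1 h
  induction hr with
  | @vertex a' v' w' =>
    have hv : K.ghostProj Y (K.pt v') =
      (K.faceAttachment Y).incl ((K.edgeAttachment Y).incl (GhostVertex.mk Y v')) := rfl
    rw [hv] at hx
    exact absurd ((K.faceAttachment Y).incl_injective hx)
      ((K.edgeAttachment Y).incl_ne_char (j := e) ht)
  | @edge a' e' w' t' q' ht' =>
    obtain ⟨rfl, rfl⟩ := (K.edgeAttachment Y).char_eq ht' ((K.faceAttachment Y).incl_injective hx)
    exact rel_edgeTail _ _ _ _
  | @face a' f w' z q hz =>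
    exact absurd hx.symm
      ((K.faceAttachment Y).incl_ne_char (a := K.ghostEdge Y e t) (j := f) hz)

theorem Based.rel_face_interior {x : K.GhostQuotient Y} {r : Path (K.ghostBase Y y₁) x}
    (hr : K.Based Y y₁ r) {a : Y} {f : F} (w : K.Walk a (K.base f)) {z : Disk}
    (hz : z ∉ (K.faceAttachment Y).bdry) (q : Path (diskBoundary 0) z)
    (hx : x = K.faceChar Y f z) :
    Rel (K.ghostSubgroup Y y₁) r (K.faceTail Y y₁ f w q) := by
  induction hr with
  | @vertex a' v' w' =>
    have hv : K.ghostProj Y (K.pt v') =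
      (K.faceAttachment Y).incl ((K.edgeAttachment Y).incl (GhostVertex.mk Y v')) := rfl
    rw [hv] at hx
    exact absurd hx ((K.faceAttachment Y).incl_ne_char (j := f) hz)
  | @edge a' e' w' t' q' ht' =>
    exact absurd hx ((K.faceAttachment Y).incl_ne_char (a := K.ghostEdge Y e' t') (j := f) hz)
  | @face a' f' w' z' q' hz' =>
    obtain ⟨rfl, rfl⟩ := (K.faceAttachment Y).char_eq hz' hx
    exact rel_faceTail _ _ _ _

variable (K Y y₁)

theorem exists_based [ConnectedSpace K.Realization] (x : K.GhostQuotient Y) :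
    ∃ r : Path (K.ghostBase Y y₁) x, K.Based Y y₁ r := by
  rcases (K.faceAttachment Y).exists_eq x with ⟨a, rfl⟩ | ⟨f, z, hz, rfl⟩
  · rcases (K.edgeAttachment Y).exists_eq a with ⟨⟨v⟩, rfl⟩ | ⟨e, t, ht, rfl⟩
    · obtain ⟨w⟩ := K.nonempty_walk (y₁ : V) v
      exact ⟨_, .vertex w⟩
    · obtain ⟨w⟩ := K.nonempty_walk (y₁ : V) (K.src e)
      exact ⟨_, .edge e w (PathConnectedSpace.somePath 0 t) ht⟩
  · obtain ⟨w⟩ := K.nonempty_walk (y₁ : V) (K.base f)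
    exact ⟨_, .face f w (PathConnectedSpace.somePath _ z) hz⟩

/-- The fundamental group of `Σ/Y` is generated by the edge paths between ghost vertices. -/
theorem ghostSubgroup_eq_top [ConnectedSpace K.Realization] : K.ghostSubgroup Y y₁ = ⊤ := by
  choose c hc using K.exists_based Y y₁
  have hw : ∀ v, Nonempty (K.Walk y₁ v) := K.nonempty_walk _
  -- It remains to show that every path of `Σ/Y` belongs to `S`, first in the 1-skeleton and then
  -- across the faces.
  let S := LoopGroup.pathSystem (K.ghostSubgroup Y y₁) c
  have hskel : ∀ {x y : K.GhostSkeleton Y} (p : Path x y),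
      (S.comap (K.ghostSkeletonIncl Y)).Mem p := by
    intro x y p
    refine (K.edgeAttachment Y).mem_pathSystem _ ?_ ?_ p
    · intro a b p
      refine PathSystem.of_const _ fun t => ?_
      have h := PreconnectedSpace.constant inferInstance p.continuous (x := t) (y := 0)
      exact h.trans p.source
    · intro e s t p
      obtain ⟨w⟩ := hw (K.src e)
      let q : Path 0 s := PathConnectedSpace.somePath 0 s
      have h1 := (hc (K.edgeChar Y e s)).rel_edge w q rfl
      have h2 := (hc (K.edgeChar Y e t)).rel_edge w (q.trans p) rfl
      exact (h1.append fun _ => rfl).trans (.trans (rel_of_homotopic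
        (trans_map_homotopic _ _ q p _)) h2.symm)
  have hface : ∀ (f : F) {a : Y} (w : K.Walk a (K.base f)) {z : Disk}
      (q : Path (diskBoundary 0) z),
      Rel (K.ghostSubgroup Y y₁) (c (K.faceChar Y f z)) (K.faceTail Y y₁ f w q) := by
    intro f a w z q
    by_cases hz : z ∈ (K.faceAttachment Y).bdry
    · obtain ⟨t, rfl⟩ := exists_diskBoundary_eq hz
      -- The choice of path inside the disk is immaterial, so it is taken along the boundary circle.
      -- Its image then runs in the 1-skeleton, where membership in `S` is known.
      let m : Path (0 : I) t := PathConnectedSpace.somePath 0 t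
      let arc : Path (diskBoundary 0) (diskBoundary t) := m.map continuous_diskBoundary
      refine Rel.trans ?_ (rel_faceTail w w arc q)
      let p : Path (K.ghostSkeletonProj Y (K.skeletonPath (K.boundary f) 0))
          (K.ghostSkeletonProj Y (K.skeletonPath (K.boundary f) t)) :=
        m.map ((K.ghostSkeletonProj Y).continuous.comp (K.skeletonPath (K.boundary f)).continuous)
      have hp : S.Mem ((arc.map (K.faceChar Y f).continuous).cast
          (K.faceChar_zero Y f).symm rfl) :=
        S.of_eq (fun s => congrArg (K.ghostProj Y) (K.faceMap_diskBoundary f (m s)).symm)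
          (hskel p)
      refine (Rel.trans ?_ hp).symm
      exact ((hc _).rel_vertex w rfl).symm.append fun _ => rfl
    · exact (hc _).rel_face_interior w hz q rfl
  have hall : ∀ {x y : K.GhostQuotient Y} (p : Path x y), S.Mem p := by
    intro x y p
    refine (K.faceAttachment Y).mem_pathSystem S hskel ?_ p
    intro f z z' p
    obtain ⟨w⟩ := hw (K.base f)
    let q : Path (diskBoundary 0) z := PathConnectedSpace.somePath _ z
    exact ((hface f w q).append fun _ => rfl).trans
      (.trans (rel_of_homotopic (trans_map_homotopic _ _ q p _)) (hface f w (q.trans p)).symm)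
  rw [eq_top_iff]
  rintro x -
  obtain ⟨p, rfl⟩ := LoopGroup.mk_surjective x
  -- The path chosen for the base point itself represents an element of the subgroup, so closing up
  -- a loop with it does not affect membership.
  have hb : Rel (K.ghostSubgroup Y y₁) (c (K.ghostBase Y y₁)) (Path.refl _) :=
    ((hc _).rel_vertex (EdgePath.nil (y₁ : V)) rfl).trans (rel_of_eq fun _ => rfl)
  refine mk_mem_of_rel (.trans ?_ (.trans (hall p) hb))
  refine (rel_of_homotopic ⟨(Path.Homotopy.reflTrans p).symm⟩).trans ?_
  exact hb.symm.append fun _ => rfl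

end TwoComplex

end
-- Holonomies of flat connections and their data
noncomputable section

open unitInterval

namespace TwoComplex

variable {V E F : Type*} (K : TwoComplex V E F)

open LoopGroup GroupCSS

/-- Homomorphisms on `π₁(Σ/Y)` are determined by the edge paths between ghost vertices. -/
theorem ghost_hom_ext [ConnectedSpace K.Realization] {G : Type*} [Group G] {Y : Set V} {y₁ : Y}
    {ψ ψ' : LoopGroup (K.GhostQuotient Y) (K.ghostProj Y (K.pt y₁)) →* G}
    (h : ∀ (a b : Y) (p : K.Walk a b), ψ (LoopGroup.mk (K.ghostLoop Y y₁ p)) =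
      ψ' (LoopGroup.mk (K.ghostLoop Y y₁ p))) : ψ = ψ' := by
  refine MonoidHom.eq_of_eqOn_dense (K.ghostSubgroup_eq_top Y y₁) ?_
  rintro _ ⟨a, b, p, rfl⟩
  exact h a b p

/-- The identification of a single point does not change the space. -/
def ghostSingletonInv (v : V) : C(K.GhostQuotient {v}, K.Realization) where
  toFun := Quot.lift id (by
    rintro _ _ ⟨⟨a, rfl, rfl⟩, ⟨b, rfl, rfl⟩⟩
    rfl)
  continuous_toFun := continuous_quot_lift _ continuous_id

/-- Homomorphisms on `π₁(Σ)` are determined by the closed edge paths. -/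
theorem hom_ext [ConnectedSpace K.Realization] {G : Type*} [Group G] {v : V}
    {φ φ' : LoopGroup K.Realization (K.pt v) →* G}
    (h : ∀ p : K.Walk v v, φ (LoopGroup.mk (K.path p)) = φ' (LoopGroup.mk (K.path p))) :
    φ = φ' := by
  -- With the single ghost vertex `v` nothing is identified, and generation for `Σ/Y` becomes
  -- generation for `Σ`.
  let y : ({v} : Set V) := ⟨v, rfl⟩
  let m : LoopGroup (K.GhostQuotient {v}) (K.ghostProj {v} (K.pt y)) →*
    LoopGroup K.Realization (K.pt v) := LoopGroup.map (K.ghostSingletonInv v) _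
  have h1 : φ.comp m = φ'.comp m := by
    refine K.ghost_hom_ext ?_
    rintro ⟨a, rfl⟩ ⟨b, rfl⟩ p
    exact h p
  ext x
  obtain ⟨p, rfl⟩ := LoopGroup.mk_surjective x
  exact DFunLike.congr_fun h1 (LoopGroup.mk (p.map (K.ghostProj {v}).continuous))

/-- Every flat connection has a holonomy. -/
theorem exists_isHolonomy {G : Type*} [Group G] (Y : Set V) (y₁ : Y) {g : E → G}
    (hg : K.IsFlat g) : ∃ ψ, K.IsHolonomy Y y₁ g ψ := by
  obtain ⟨B, _, b, ⟨θ⟩⟩ := exists_loopGroup_mulEquiv G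
  have hl : ∀ x : G, ∃ l : Path b b, θ (LoopGroup.mk l) = x := fun x => by
    obtain ⟨l, hl⟩ := LoopGroup.mk_surjective (θ.symm x)
    exact ⟨l, by rw [hl, θ.apply_symm_apply]⟩
  choose l hl using hl
  -- All vertices go to `b`; for this reason the map will later factor through `Σ/Y` whatever `Y`
  -- is.
  let s : C(K.Skeleton, B) :=
    ⟨Quot.lift (Sum.elim (fun _ => b) fun p => l (g p.1) p.2) (by
      rintro _ _ (e | e) <;> simp),
      continuous_quot_lift _ (continuous_sumElim.2 ⟨continuous_sigma fun _ => continuous_const,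
        continuous_sigma fun e => (l (g e)).continuous⟩)⟩
  let L : ∀ {v w : V}, K.Walk v w → Path b b := fun p => (K.skeletonPath p).map s.continuous
  have hL : ∀ {v w : V} (p : K.Walk v w), θ (LoopGroup.mk (L p)) = evalWord g p.word := by
    intro v w p
    induction p with
    | nil v =>
      have : L (EdgePath.nil v) = Path.refl b := rfl
      rw [this, LoopGroup.mk_refl, map_one, evalWord_nil]
    | fwd e p ih =>
      have : L (EdgePath.fwd e p) = (l (g e)).trans (L p) := Path.map_trans _ _ _
      rw [this, ← LoopGroup.mk_mul_mk, map_mul, ih, hl, evalWord_fwd]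
    | bwd e p ih =>
      have : L (EdgePath.bwd e p) = (l (g e)).symm.trans (L p) := Path.map_trans _ _ _
      rw [this, ← LoopGroup.mk_mul_mk, map_mul, ih, LoopGroup.mk_symm, map_inv, hl, evalWord_bwd]
  -- Flatness is used here: a loop in `B` with trivial class is null-homotopic and so extends over
  -- the disk.
  have hnull : ∀ f, (L (K.boundary f)).Homotopic (Path.refl b) := fun f => by
    rw [← LoopGroup.mk_eq_mk_iff, ← θ.apply_eq_iff_eq, hL, LoopGroup.mk_refl, map_one]
    exact hg f
  choose d hd using fun f => exists_disk_extension _ (hnull f)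
  let r : C(K.Realization, B) :=
    ⟨Quot.lift (Sum.elim s fun p => d p.1 p.2) (by
      rintro _ _ ⟨f, t⟩
      exact hd f t),
      continuous_quot_lift _ (continuous_sumElim.2 ⟨s.continuous,
        continuous_sigma fun f => (d f).continuous⟩)⟩
  let q : C(K.GhostQuotient Y, B) :=
    ⟨Quot.lift r (by
      rintro _ _ ⟨⟨v, hv, rfl⟩, ⟨w, hw, rfl⟩⟩
      rfl), continuous_quot_lift _ r.continuous⟩
  exact ⟨θ.toMonoidHom.comp (LoopGroup.map q _), fun a b p => hL p⟩

/-- The connection obtained from a multiplicative function of edge paths. -/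
theorem evalWord_eq_of_multiplicative {G : Type*} [Group G] (ρ : ∀ {v w : V}, K.Walk v w → G)
    (hnil : ∀ v, ρ (.nil v) = 1)
    (happend : ∀ {u v w : V} (p : K.Walk u v) (q : K.Walk v w), ρ (p.append q) = ρ p * ρ q)
    (hreverse : ∀ {v w : V} (p : K.Walk v w), ρ p.reverse = (ρ p)⁻¹)
    {v w : V} (p : K.Walk v w) :
    evalWord (fun e => ρ (.single e)) p.word = ρ p := by
  induction p with
  | nil v => rw [hnil, evalWord_nil]
  | fwd e p ih => rw [evalWord_fwd, ih, ← happend]; rfl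
  | bwd e p ih => rw [evalWord_bwd, ih, ← hreverse, ← happend]; rfl

/-! ### Closing up edge paths at the base point -/

theorem mk_path_append {u v w : V} (p : K.Walk u v) (q : K.Walk v w) :
    Path.Homotopic.Quotient.mk (K.path (p.append q)) =
      (Path.Homotopic.Quotient.mk (K.path p)).trans (Path.Homotopic.Quotient.mk (K.path q)) :=
  Path.Homotopic.Quotient.eq.2 (K.path_append p q)

theorem mk_path_reverse {u v : V} (p : K.Walk u v) :
    Path.Homotopic.Quotient.mk (K.path p.reverse) =
      (Path.Homotopic.Quotient.mk (K.path p)).symm :=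
  Path.Homotopic.Quotient.eq.2 (K.path_reverse p)

/-- The class of the loop `δ_v p δ_w⁻¹`. -/
def closedClass {u : V} (δ : ∀ v, K.Walk u v) {v w : V} (p : K.Walk v w) :
    LoopGroup K.Realization (K.pt u) :=
  LoopGroup.mk (K.path ((δ v).append (p.append (δ w).reverse)))

variable {K} {u : V} (δ : ∀ v, K.Walk u v)

theorem closedClass_append {v w x : V} (p : K.Walk v w) (q : K.Walk w x) :
    K.closedClass δ (p.append q) = K.closedClass δ p * K.closedClass δ q := by
  rw [closedClass, closedClass, closedClass, mk_mul_mk, mk_eq_mk_iff,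
    ← Path.Homotopic.Quotient.eq]
  simp only [Path.Homotopic.Quotient.mk_trans, mk_path_append, mk_path_reverse,
    Path.Homotopic.Quotient.trans_assoc, Path.Homotopic.Quotient.symm_trans_cancel]

theorem closedClass_of_homotopic_refl {v : V} {p : K.Walk v v}
    (hp : (K.path p).Homotopic (Path.refl _)) : K.closedClass δ p = 1 := by
  rw [← Path.Homotopic.Quotient.eq, Path.Homotopic.Quotient.mk_refl] at hp
  rw [closedClass, ← LoopGroup.mk_refl, mk_eq_mk_iff, ← Path.Homotopic.Quotient.eq]
  simp only [mk_path_append, mk_path_reverse, hp, Path.Homotopic.Quotient.refl_trans,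
    Path.Homotopic.Quotient.trans_symm, Path.Homotopic.Quotient.mk_refl]

theorem closedClass_nil (v : V) : K.closedClass δ (EdgePath.nil v) = 1 :=
  closedClass_of_homotopic_refl δ (Path.Homotopic.refl _)

theorem closedClass_reverse {v w : V} (p : K.Walk v w) :
    K.closedClass δ p.reverse = (K.closedClass δ p)⁻¹ := by
  rw [eq_comm, inv_eq_iff_mul_eq_one, ← closedClass_append]
  exact closedClass_of_homotopic_refl δ (K.path_append_reverse p)

theorem closedClass_base (hδ : δ u = .nil u) (p : K.Walk u u) :
    K.closedClass δ p = LoopGroup.mk (K.path p) := by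
  rw [closedClass, mk_eq_mk_iff, ← Path.Homotopic.Quotient.eq]
  have h : Path.Homotopic.Quotient.mk (K.path (δ u)) = Path.Homotopic.Quotient.refl _ := by
    rw [hδ]; rfl
  simp only [mk_path_append, mk_path_reverse, h, Path.Homotopic.Quotient.refl_trans]
  exact Path.Homotopic.Quotient.trans_refl _

theorem closedClass_self (hδ : δ u = .nil u) (v : V) : K.closedClass δ (δ v) = 1 := by
  rw [closedClass, ← LoopGroup.mk_refl, mk_eq_mk_iff, ← Path.Homotopic.Quotient.eq]
  have h : Path.Homotopic.Quotient.mk (K.path (δ u)) = Path.Homotopic.Quotient.refl _ := by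
    rw [hδ]; rfl
  simp only [mk_path_append, mk_path_reverse, h, Path.Homotopic.Quotient.refl_trans,
    Path.Homotopic.Quotient.trans_symm, Path.Homotopic.Quotient.mk_refl]

variable (K)

/-- The given edge paths to the ghost vertices extend to edge paths to all vertices. -/
theorem exists_walks [ConnectedSpace K.Realization] (Y : Set V) (y₁ : Y)
    (γ : ∀ y : {y : Y // y ≠ y₁}, K.Walk y₁ y.1) :
    ∃ δ : ∀ v, K.Walk y₁ v, δ y₁ = .nil _ ∧ ∀ y : {y : Y // y ≠ y₁}, δ y.1 = γ y := by
  -- The conditions are transported along equalities of vertices so that the choice can be made for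
  -- each `v` separately.
  have h : ∀ v, ∃ w : K.Walk y₁ v, (∀ h : v = y₁, h ▸ w = .nil (y₁ : V)) ∧
      ∀ y : {y : Y // y ≠ y₁}, ∀ h : v = y.1, h ▸ w = γ y := by
    intro v
    by_cases h1 : v = y₁
    · subst h1
      exact ⟨.nil _, fun _ => rfl, fun y h => absurd (Subtype.ext h.symm) y.2⟩
    by_cases h2 : v ∈ Y
    · refine ⟨γ ⟨⟨v, h2⟩, fun h => h1 (congrArg Subtype.val h)⟩, fun h => absurd h h1, ?_⟩
      rintro ⟨⟨y, hy⟩, hy'⟩ h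
      cases h
      rfl
    · obtain ⟨w⟩ := K.nonempty_walk (y₁ : V) v
      exact ⟨w, fun h => absurd h h1, fun y h => absurd (h ▸ y.1.2) h2⟩
  choose δ h1 h2 using h
  exact ⟨δ, h1 _ rfl, fun y => h2 _ y rfl⟩

variable {G : Type*} [Group G] (Y : Set V) (y₁ : Y) (γ : ∀ y : {y : Y // y ≠ y₁}, K.Walk y₁ y.1)

/-- The loops of `Σ` at the base point and the chosen edge paths determine a homomorphism. -/
theorem holonomyData_injective [ConnectedSpace K.Realization] :
    Function.Injective (K.holonomyData (G := G) Y y₁ γ) := by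
  intro ψ ψ' h
  obtain ⟨δ, hδ, hγ⟩ := K.exists_walks Y y₁ γ
  have hloop : ∀ p : K.Walk y₁ y₁, ψ (K.ghostClass Y y₁ p) = ψ' (K.ghostClass Y y₁ p) :=
    fun p => DFunLike.congr_fun (congrArg Prod.fst h) (LoopGroup.mk (K.path p))
  have hδψ : ∀ a : Y, ψ (K.ghostClass Y y₁ (δ a)) = ψ' (K.ghostClass Y y₁ (δ a)) := by
    intro a
    by_cases ha : a = y₁
    · subst ha
      exact hloop _
    · have := hγ ⟨a, ha⟩
      simp only at this
      rw [this]
      exact congrFun (congrArg Prod.snd h) ⟨a, ha⟩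
  refine K.ghost_hom_ext fun a b p => ?_
  -- The path `δ_a p δ_b⁻¹` is a loop of `Σ` at `y₁`, and the values on `δ_a` and `δ_b` agree, so
  -- they cancel.
  have h1 := hloop ((δ a).append (p.append (δ b).reverse))
  rw [K.ghostClass_append Y y₁ (b := a), K.ghostClass_append Y y₁ (b := b), map_mul, map_mul,
    map_mul, map_mul, K.ghostClass_reverse, map_inv, map_inv, hδψ a, hδψ b] at h1
  exact mul_right_cancel (mul_left_cancel h1)

/-- All data are realized by the holonomy of a flat connection. -/
theorem exists_flat_of_data [ConnectedSpace K.Realization]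
    (φ : LoopGroup K.Realization (K.pt y₁) →* G) (c : {y : Y // y ≠ y₁} → G) :
    ∃ g : E → G, K.IsFlat g ∧ ∃ ψ, K.IsHolonomy Y y₁ g ψ ∧ K.holonomyData Y y₁ γ ψ = (φ, c) := by
  classical
  obtain ⟨δ, hδ, hγ⟩ := K.exists_walks Y y₁ γ
  let k : V → G := fun v => if h : ∃ hv : v ∈ Y, (⟨v, hv⟩ : Y) ≠ y₁ then c ⟨⟨v, h.1⟩, h.2⟩ else 1
  have hk : ∀ y : {y : Y // y ≠ y₁}, k y.1 = c y := fun y => dif_pos ⟨y.1.2, y.2⟩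
  have hk1 : k y₁ = 1 := dif_neg fun h => h.2 rfl
  -- The closed-up class of `δ v` is trivial, so `ρ` takes the value `k v` on `δ v`, which is `c y`
  -- on `γ y`; on loops at `y₁` it is `φ`, because `k y₁ = 1`.
  let ρ : ∀ {v w : V}, K.Walk v w → G := fun {v w} p => (k v)⁻¹ * φ (K.closedClass δ p) * k w
  have hρ : ∀ {v w : V} (p : K.Walk v w), evalWord (fun e => ρ (.single e)) p.word = ρ p := by
    refine K.evalWord_eq_of_multiplicative ρ ?_ ?_ ?_
    · intro v
      simp only [ρ, closedClass_nil, map_one]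
      group
    · intro u v w p q
      simp only [ρ, closedClass_append, map_mul]
      group
    · intro v w p
      simp only [ρ, closedClass_reverse, map_inv]
      group
  have hflat : K.IsFlat fun e => ρ (.single e) := by
    intro f
    rw [hρ]
    simp only [ρ, closedClass_of_homotopic_refl δ (K.path_boundary f), map_one]
    group
  obtain ⟨ψ, hψ⟩ := K.exists_isHolonomy Y y₁ hflat
  refine ⟨_, hflat, ψ, hψ, Prod.ext ?_ (funext fun y => ?_)⟩
  · refine K.hom_ext fun p => ?_
    refine (hψ y₁ y₁ p).trans ?_
    rw [hρ]
    simp only [ρ, hk1, closedClass_base δ hδ]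
    group
  · refine (hψ y₁ y.1 (γ y)).trans ?_
    rw [hρ, ← hγ]
    simp only [ρ, hk1, hk, closedClass_self δ hδ, map_one]
    group

theorem holonomyData_bijective [ConnectedSpace K.Realization] :
    Function.Bijective (K.holonomyData (G := G) Y y₁ γ) :=
  ⟨K.holonomyData_injective Y y₁ γ, fun ⟨φ, c⟩ =>
    let ⟨_, _, ψ, _, h⟩ := K.exists_flat_of_data Y y₁ γ φ c
    ⟨ψ, h⟩⟩

variable {Y y₁} in
theorem IsHolonomy.unique [ConnectedSpace K.Realization] {g : E → G}
    {ψ ψ' : LoopGroup (K.GhostQuotient Y) (K.ghostProj Y (K.pt y₁)) →* G}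
    (h : K.IsHolonomy Y y₁ g ψ) (h' : K.IsHolonomy Y y₁ g ψ') : ψ = ψ' :=
  K.ghost_hom_ext fun a b p => (h a b p).trans (h' a b p).symm

theorem existsUnique_isHolonomy [ConnectedSpace K.Realization] {g : E → G} (hg : K.IsFlat g) :
    ∃! ψ, K.IsHolonomy Y y₁ g ψ :=
  let ⟨ψ, hψ⟩ := K.exists_isHolonomy Y y₁ hg
  ⟨ψ, hψ, fun _ h => h.unique K hψ⟩

theorem exists_flat_of_hom [ConnectedSpace K.Realization]
    (ψ : LoopGroup (K.GhostQuotient Y) (K.ghostProj Y (K.pt y₁)) →* G) :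
    ∃ g : E → G, K.IsFlat g ∧ K.IsHolonomy Y y₁ g ψ := by
  let γ : ∀ y : {y : Y // y ≠ y₁}, K.Walk y₁ y.1 := fun y => (K.nonempty_walk _ _).some
  obtain ⟨g, hg, ψ', hψ', h⟩ := K.exists_flat_of_data Y y₁ γ
    (K.holonomyData Y y₁ γ ψ).1 (K.holonomyData Y y₁ γ ψ).2
  obtain rfl := K.holonomyData_injective Y y₁ γ h
  exact ⟨g, hg, hψ'⟩

end TwoComplex

end
noncomputable section

namespace GroupCSS

variable {E G : Type*} [Group G]

/-! ### Eigenvectors of checks -/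

omit [Group G] in
theorem mem_codespace {S : Set (HilbertSpace E G →ₗ[ℂ] HilbertSpace E G)}
    {x : HilbertSpace E G} : x ∈ codespace S ↔ ∀ T ∈ S, T x = x := by
  simp [codespace, Submodule.mem_iInf, LinearMap.mem_ker, sub_eq_zero]

/-- The check permutes the basis, so a fixed vector is one whose coefficients are invariant under
the permutation. -/
theorem xCheck_apply_eq_iff (a b : E → G) (x : HilbertSpace E G) :
    xCheck a b x = x ↔ ∀ g : E → G, x (fun e => a e * g e * (b e)⁻¹) = x g := by
  have hinj : Function.Injective fun (g : E → G) e => a e * g e * (b e)⁻¹ := by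
    intro g g' h
    funext e
    simpa using congrFun h e
  constructor
  · intro h g
    conv_lhs => rw [← h]
    exact Finsupp.mapDomain_apply hinj x g
  · intro h
    ext g
    obtain ⟨g', rfl⟩ : ∃ g' : E → G, (fun e => a e * g' e * (b e)⁻¹) = g :=
      ⟨fun e => (a e)⁻¹ * g e * b e, by funext e; group⟩
    rw [h]
    exact Finsupp.mapDomain_apply hinj x g'

open Classical in
theorem zCheck_apply (L : Subgroup G) (w : List (E × Bool)) (x : HilbertSpace E G) (g : E → G) :
    zCheck L w x g = if evalWord g w ∈ L then x g else 0 := by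
  induction x using Finsupp.induction_linear with
  | zero => simp
  | add x y hx hy =>
    rw [map_add, Finsupp.add_apply, hx, hy]
    split_ifs <;> simp
  | single g' c =>
    rw [zCheck, Finsupp.linearCombination_single]
    by_cases h : g' = g
    · subst h
      split_ifs <;> simp
    · split_ifs <;> simp [Finsupp.single_eq_of_ne' h, ket]

theorem zCheck_apply_eq_iff (L : Subgroup G) (w : List (E × Bool)) (x : HilbertSpace E G) :
    zCheck L w x = x ↔ ∀ g : E → G, evalWord g w ∉ L → x g = 0 := by
  classical
  constructor
  · intro h g hg
    rw [← h, zCheck_apply, if_neg hg]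
  · intro h
    ext g
    rw [zCheck_apply]
    split_ifs with hg
    · rfl
    · exact (h g hg).symm

omit [Group G] in
theorem superposition_apply [Finite E] [Finite G] (S : Set (E → G)) (g : E → G) :
    superposition S g = S.indicator (fun _ => 1) g := rfl

omit [Group G] in
/-- A space of states that are supported on `P` and constant on the fibres of `q` has a basis
of superpositions. -/
theorem exists_superposition_equiv [Finite E] [Finite G] {Ω : Type*} {P : (E → G) → Prop}
    {q : {g // P g} → Ω} (hq : Function.Surjective q) (W : Submodule ℂ (HilbertSpace E G))
    (hW : ∀ x, x ∈ W ↔ (∀ g, ¬ P g → x g = 0) ∧ ∀ g g' : {g // P g}, q g = q g' → x g = x g') :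
    ∃ Θ : (Ω →₀ ℂ) ≃ₗ[ℂ] W, ∀ ω, (Θ (Finsupp.single ω 1) : HilbertSpace E G) =
      superposition {g | ∃ h : P g, q ⟨g, h⟩ = ω} := by
  classical
  have : Finite Ω := Finite.of_surjective q hq
  let L : (Ω →₀ ℂ) →ₗ[ℂ] HilbertSpace E G :=
    Finsupp.linearCombination ℂ fun ω => superposition {g | ∃ h : P g, q ⟨g, h⟩ = ω}
  have hL : ∀ c g, L c g = if h : P g then c (q ⟨g, h⟩) else 0 := by
    intro c g
    induction c using Finsupp.induction_linear with
    | zero => simp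
    | add c d hc hd =>
      rw [map_add, Finsupp.add_apply, hc, hd]
      split_ifs <;> simp
    | single ω c =>
      rw [Finsupp.linearCombination_single, Finsupp.smul_apply, superposition_apply,
        Set.indicator_apply]
      by_cases h : P g
      · simp [h, Finsupp.single_apply, eq_comm]
      · simp [h]
  have hmem : ∀ c, L c ∈ W := fun c => (hW _).2
    ⟨fun g hg => by rw [hL, dif_neg hg], fun g g' h => by
      rw [hL, hL, dif_pos g.2, dif_pos g'.2]
      exact congrArg c h⟩
  refine ⟨LinearEquiv.ofBijective (L.codRestrict W hmem) ⟨?_, ?_⟩, fun ω => ?_⟩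
  · intro c d h
    ext ω
    obtain ⟨g, rfl⟩ := hq ω
    have h1 : L c g = L d g := DFunLike.congr_fun (congrArg Subtype.val h) g.1
    rwa [hL, hL, dif_pos g.2, dif_pos g.2] at h1
  · rintro ⟨x, hx⟩
    obtain ⟨h1, h2⟩ := (hW x).1 hx
    -- Any representative of the fibre supplies the coefficient, since `x` is constant there.
    refine ⟨Finsupp.equivFunOnFinite.symm fun ω => x (Function.surjInv hq ω).1, Subtype.ext ?_⟩
    ext g
    change L _ g = x g
    rw [hL]
    split_ifs with hg
    · exact h2 _ ⟨g, hg⟩ (Function.surjInv_eq hq _)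
    · exact (h1 g hg).symm
  · change L _ = _
    rw [Finsupp.linearCombination_single, one_smul]

end GroupCSS

namespace TwoComplex

open GroupCSS

variable {V E F G : Type*} [Group G] (K : TwoComplex V E F)

/-! ### Gauge transformations -/

/-- The gauge transformation of connections by `k : V → G`. -/
def gauge (k : V → G) (g : E → G) : E → G := fun e => k (K.src e) * g e * (k (K.tgt e))⁻¹

theorem gauge_mul (k k' : V → G) (g : E → G) : K.gauge (k * k') g = K.gauge k (K.gauge k' g) := by
  funext e
  simp only [gauge, Pi.mul_apply]
  group

theorem gauge_one (g : E → G) : K.gauge 1 g = g := by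
  funext e
  simp [gauge]

/-- The gauge factors at the inner vertices of the path cancel. -/
theorem evalWord_gauge (k : V → G) (g : E → G) {v w : V} (p : K.Walk v w) :
    evalWord (K.gauge k g) p.word = k v * evalWord g p.word * (k w)⁻¹ := by
  induction p with
  | nil v => simp [evalWord_nil]
  | fwd e p ih =>
    rw [evalWord_fwd, evalWord_fwd, ih, gauge]
    group
  | bwd e p ih =>
    rw [evalWord_bwd, evalWord_bwd, ih, gauge]
    group

theorem IsFlat.gauge {g : E → G} (hg : K.IsFlat g) (k : V → G) : K.IsFlat (K.gauge k g) := by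
  intro f
  rw [evalWord_gauge, hg f]
  group

open Classical in
theorem vertexCheck_apply_eq_iff (v : V) (h : G) (x : HilbertSpace E G) :
    K.vertexCheck v h x = x ↔ ∀ g, x (K.gauge (Pi.mulSingle v h) g) = x g := by
  have : ∀ g : E → G, K.gauge (Pi.mulSingle v h) g = fun e =>
      (if K.src e = v then h else 1) * g e * (if K.tgt e = v then h else 1)⁻¹ := by
    intro g
    funext e
    simp only [gauge, Pi.mulSingle_apply]
  simp only [this]
  exact xCheck_apply_eq_iff _ _ _

/-- A vertex check is a gauge transformation supported at one vertex. As `V` is finite, every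
admissible `k` is a product of these, so invariance under the checks is invariance under the whole
gauge group. -/
theorem mem_quantumDouble_iff [Finite V] {Y : Set V} {H : Y → Subgroup G}
    {x : HilbertSpace E G} :
    x ∈ K.quantumDouble Y H ↔ (∀ g, ¬ K.IsFlat g → x g = 0) ∧
      ∀ (k : V → G), (∀ y : Y, k y ∈ H y) → ∀ g, x (K.gauge k g) = x g := by
  classical
  rw [quantumDouble, mem_codespace]
  constructor
  · intro h
    constructor
    · intro g hg
      simp only [IsFlat, not_forall] at hg
      obtain ⟨f, hf⟩ := hg
      exact (zCheck_apply_eq_iff _ _ _).1 (h _ (Or.inr ⟨f, rfl⟩)) g (by simpa using hf)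
    · intro k hk
      have hv : ∀ v g, x (K.gauge (Pi.mulSingle v (k v)) g) = x g := by
        intro v
        rw [← vertexCheck_apply_eq_iff]
        by_cases hv : v ∈ Y
        · exact h _ (Or.inl (Or.inr ⟨⟨v, hv⟩, k v, hk ⟨v, hv⟩, rfl⟩))
        · exact h _ (Or.inl (Or.inl ⟨v, hv, k v, rfl⟩))
      have hs : ∀ (s : Finset V) g, x (K.gauge (fun v => if v ∈ s then k v else 1) g) = x g := by
        intro s
        induction s using Finset.induction_on with
        | empty =>
          intro g
          simp only [Finset.notMem_empty, if_false]
          exact congrArg x (K.gauge_one g)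
        | insert v s hvs ih =>
          intro g
          have : (fun w => if w ∈ insert v s then k w else 1) =
              Pi.mulSingle v (k v) * fun w => if w ∈ s then k w else 1 := by
            funext w
            by_cases hw : w = v
            · subst hw
              simp [hvs]
            · simp [hw]
          rw [this, gauge_mul, hv, ih]
      have := Fintype.ofFinite V
      simpa using hs Finset.univ
  · rintro ⟨h1, h2⟩ T ((⟨v, hv, h, rfl⟩ | ⟨y, h, hh, rfl⟩) | ⟨f, rfl⟩)
    · rw [vertexCheck_apply_eq_iff]
      refine h2 _ fun y => ?_
      rw [Pi.mulSingle_eq_of_ne (fun hy => hv (by rw [← hy]; exact y.2))]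
      exact one_mem _
    · rw [vertexCheck_apply_eq_iff]
      refine h2 _ fun y' => ?_
      by_cases hy : y' = y
      · subst hy
        rwa [Pi.mulSingle_eq_same]
      · rw [Pi.mulSingle_eq_of_ne (fun h => hy (Subtype.ext h))]
        exact one_mem _
    · refine (zCheck_apply_eq_iff _ _ _).2 fun g hg => h1 g fun hf => hg ?_
      rw [hf f]
      exact one_mem _

/-! ### The action on holonomies -/

section Action

variable (Y : Set V) (H : Y → Subgroup G) (y₁ : Y) (γ : ∀ y : {y : Y // y ≠ y₁}, K.Walk y₁ y.1)

/-- The action of the ghost gauge group on holonomy data. -/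
@[reducible]
def dataAction (P : Type*) [Group P] :
    MulAction (∀ y : Y, H y) ((P →* G) × ({y : Y // y ≠ y₁} → G)) where
  smul h d := ((MulAut.conj (h y₁ : G)).toMonoidHom.comp d.1,
    fun y => (h y₁ : G) * d.2 y * (h y.1 : G)⁻¹)
  one_smul d := Prod.ext (MonoidHom.ext fun x => by
      change (1 : G) * d.1 x * 1⁻¹ = d.1 x
      group) (funext fun y => by
      change (1 : G) * d.2 y * 1⁻¹ = d.2 y
      group)
  mul_smul h h' d := Prod.ext (MonoidHom.ext fun x => by
      change ((h y₁ : G) * h' y₁) * d.1 x * ((h y₁ : G) * h' y₁)⁻¹ =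
        h y₁ * (h' y₁ * d.1 x * (h' y₁ : G)⁻¹) * (h y₁ : G)⁻¹
      group) (funext fun y => by
      change ((h y₁ : G) * h' y₁) * d.2 y * ((h y.1 : G) * h' y.1)⁻¹ =
        h y₁ * (h' y₁ * d.2 y * (h' y.1 : G)⁻¹) * (h y.1 : G)⁻¹
      group)

/-- The compatibility of an action on holonomies with the action on their data. -/
def IsDataAction (act : MulAction (∀ y : Y, H y)
    (LoopGroup (K.GhostQuotient Y) (K.ghostProj Y (K.pt y₁)) →* G)) : Prop :=
  ∀ (h : ∀ y : Y, H y) (φ : LoopGroup K.Realization (K.pt y₁) →* G)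
    (c : {y : Y // y ≠ y₁} → G)
    (ψ : LoopGroup (K.GhostQuotient Y) (K.ghostProj Y (K.pt y₁)) →* G),
    K.holonomyData Y y₁ γ ψ = (φ, c) →
    K.holonomyData Y y₁ γ (h • ψ) =
      ((MulAut.conj (h y₁ : G)).toMonoidHom.comp φ,
        fun y => (h y₁ : G) * c y * (h y.1 : G)⁻¹)

theorem exists_isDataAction [ConnectedSpace K.Realization] :
    ∃ act, K.IsDataAction Y H y₁ γ act := by
  let e := Equiv.ofBijective _ (K.holonomyData_bijective (G := G) Y y₁ γ)
  let _ := dataAction Y H y₁ (LoopGroup K.Realization (K.pt y₁))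
  refine ⟨e.mulAction _, fun h φ c ψ hψ => ?_⟩
  change e (e.symm (h • e ψ)) = _
  rw [e.apply_symm_apply]
  change h • K.holonomyData Y y₁ γ ψ = _
  rw [hψ]
  rfl

variable {K Y H y₁ γ}
variable [act : MulAction (∀ y : Y, H y)
  (LoopGroup (K.GhostQuotient Y) (K.ghostProj Y (K.pt y₁)) →* G)]

/-- The gauged connection is flat and so has some holonomy. Its data involve `k` only at the ends of
paths between ghost vertices, which is exactly the formula of the action. -/
theorem IsDataAction.isHolonomy_gauge [ConnectedSpace K.Realization]
    (hact : K.IsDataAction Y H y₁ γ act) {g : E → G} (hg : K.IsFlat g)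
    {ψ : LoopGroup (K.GhostQuotient Y) (K.ghostProj Y (K.pt y₁)) →* G}
    (hψ : K.IsHolonomy Y y₁ g ψ) (h : ∀ y : Y, H y) {k : V → G} (hk : ∀ y : Y, k y = h y) :
    K.IsHolonomy Y y₁ (K.gauge k g) (h • ψ) := by
  obtain ⟨ψ', hψ'⟩ := K.exists_isHolonomy Y y₁ (hg.gauge K k)
  have : ψ' = h • ψ := by
    refine K.holonomyData_injective Y y₁ γ ?_
    rw [hact h _ _ ψ rfl]
    refine Prod.ext (K.hom_ext fun p => ?_) (funext fun y => ?_)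
    · refine (hψ' y₁ y₁ p).trans ?_
      rw [evalWord_gauge, hk, ← hψ y₁ y₁ p]
      rfl
    · refine (hψ' y₁ y.1 (γ y)).trans ?_
      rw [evalWord_gauge, hk, hk, ← hψ y₁ y.1 (γ y)]
  rwa [← this]

-- Compare the two transports from a ghost vertex to `v`; their discrepancy is `k v`. For an edge
-- `e`, the path to its source, then `e`, then back from its target joins ghost vertices, so both
-- connections agree on it, and this is the gauge relation at `e`.
omit act in
theorem exists_gauge_of_isHolonomy [ConnectedSpace K.Realization] {g g' : E → G}
    {ψ : LoopGroup (K.GhostQuotient Y) (K.ghostProj Y (K.pt y₁)) →* G}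
    (hψ : K.IsHolonomy Y y₁ g ψ) (hψ' : K.IsHolonomy Y y₁ g' ψ) :
    ∃ k : V → G, (∀ y : Y, k y = 1) ∧ g' = K.gauge k g := by
  have hδ : ∀ v, ∃ (a : Y) (w : K.Walk a v), v ∈ Y → ∀ g : E → G, evalWord g w.word = 1 := by
    intro v
    by_cases hv : v ∈ Y
    -- At a ghost vertex the empty path is taken, so that the gauge transformation is `1` on `Y`.
    · exact ⟨⟨v, hv⟩, .nil v, fun _ _ => rfl⟩
    · obtain ⟨w⟩ := K.nonempty_walk (y₁ : V) v
      exact ⟨y₁, w, fun h => absurd h hv⟩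
  choose a δ hδ using hδ
  refine ⟨fun v => (evalWord g' (δ v).word)⁻¹ * evalWord g (δ v).word, fun y => ?_, ?_⟩
  · simp [hδ y y.2]
  · funext e
    have h1 := (hψ _ _ ((δ (K.src e)).append ((EdgePath.single e).append
      (δ (K.tgt e)).reverse))).symm.trans (hψ' _ _ ((δ (K.src e)).append
        ((EdgePath.single e).append (δ (K.tgt e)).reverse)))
    simp only [evalWord_append, evalWord_reverse, evalWord_single] at h1
    rw [gauge]
    calc g' e = (evalWord g' (δ (K.src e)).word)⁻¹ * (evalWord g' (δ (K.src e)).word *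
          (g' e * (evalWord g' (δ (K.tgt e)).word)⁻¹)) * evalWord g' (δ (K.tgt e)).word := by group
      _ = _ := by
        rw [← h1]
        group

theorem IsDataAction.exists_gauge [ConnectedSpace K.Realization]
    (hact : K.IsDataAction Y H y₁ γ act) {g g' : E → G} (hg : K.IsFlat g)
    {ψ : LoopGroup (K.GhostQuotient Y) (K.ghostProj Y (K.pt y₁)) →* G}
    (hψ : K.IsHolonomy Y y₁ g ψ) (h : ∀ y : Y, H y) (hψ' : K.IsHolonomy Y y₁ g' (h • ψ)) :
    ∃ k : V → G, (∀ y : Y, k y ∈ H y) ∧ g' = K.gauge k g := by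
  classical
  let k : V → G := fun v => if hv : v ∈ Y then h ⟨v, hv⟩ else 1
  have hk : ∀ y : Y, k y = h y := fun y => dif_pos y.2
  obtain ⟨k', hk', rfl⟩ :=
    exists_gauge_of_isHolonomy (hact.isHolonomy_gauge hg hψ h hk) hψ'
  refine ⟨k' * k, fun y => ?_, (K.gauge_mul _ _ _).symm⟩
  rw [Pi.mul_apply, hk', hk, one_mul]
  exact (h y).2

/-- Flat connections are gauge equivalent exactly when their holonomies lie in one orbit, so
codewords are the functions constant on the fibres of the map from flat connections to orbits. -/
theorem IsDataAction.exists_equiv [ConnectedSpace K.Realization] [Finite V] [Finite E] [Finite G]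
    (hact : K.IsDataAction Y H y₁ γ act) :
    ∃ Θ : (MulAction.orbitRel.Quotient (∀ y : Y, H y)
        (LoopGroup (K.GhostQuotient Y) (K.ghostProj Y (K.pt y₁)) →* G) →₀ ℂ) ≃ₗ[ℂ]
        K.quantumDouble Y H,
      ∀ ω, (Θ (Finsupp.single ω 1) : HilbertSpace E G) =
        superposition {g | K.IsFlat g ∧ ∃ ψ, K.IsHolonomy Y y₁ g ψ ∧ Quotient.mk _ ψ = ω} := by
  choose ψ hψ using fun g : {g : E → G // K.IsFlat g} => K.exists_isHolonomy Y y₁ g.2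
  let q : {g : E → G // K.IsFlat g} → MulAction.orbitRel.Quotient (∀ y : Y, H y)
      (LoopGroup (K.GhostQuotient Y) (K.ghostProj Y (K.pt y₁)) →* G) :=
    fun g => Quotient.mk _ (ψ g)
  have hq : Function.Surjective q := by
    rintro ⟨ψ'⟩
    obtain ⟨g, hg, hψ'⟩ := K.exists_flat_of_hom Y y₁ ψ'
    exact ⟨⟨g, hg⟩, congrArg (Quotient.mk _) ((hψ ⟨g, hg⟩).unique K hψ')⟩
  obtain ⟨Θ, hΘ⟩ := exists_superposition_equiv hq (K.quantumDouble Y H) (fun x => by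
    rw [mem_quantumDouble_iff]
    refine and_congr_right fun hx => ⟨fun h g g' hgg => ?_, fun h k hk g => ?_⟩
    · obtain ⟨a, ha⟩ := Quotient.exact hgg
      obtain ⟨k, hk, hk'⟩ := hact.exists_gauge g'.2 (hψ g') a (by
        rw [show a • ψ g' = ψ g from ha]
        exact hψ g)
      rw [hk', h k hk]
    · by_cases hg : K.IsFlat g
      · refine h ⟨_, hg.gauge K k⟩ ⟨g, hg⟩ (Quotient.sound ⟨fun y => ⟨k y, hk y⟩, ?_⟩)
        exact (hact.isHolonomy_gauge hg (hψ ⟨g, hg⟩) (fun y => ⟨k y, hk y⟩)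
          fun _ => rfl).unique K (hψ ⟨_, hg.gauge K k⟩)
      · rw [hx g hg, hx]
        intro hg'
        refine hg ?_
        -- The inverse gauge transformation would make `g` flat again.
        have := hg'.gauge K k⁻¹
        rwa [← gauge_mul, inv_mul_cancel, gauge_one] at this)
  refine ⟨Θ, fun ω => (hΘ ω).trans (congrArg superposition (Set.ext fun g => ?_))⟩
  constructor
  · rintro ⟨hg, h⟩
    exact ⟨hg, _, hψ ⟨g, hg⟩, h⟩
  · rintro ⟨hg, ψ', hψ', h⟩
    refine ⟨hg, ?_⟩
    rw [← h]
    exact congrArg (Quotient.mk _) ((hψ ⟨g, hg⟩).unique K hψ')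

/-- If the first subgroup is trivial, orbits are given by a homomorphism on `π₁(Σ)` and cosets. -/
theorem IsDataAction.exists_orbit_equiv [ConnectedSpace K.Realization]
    (hact : K.IsDataAction Y H y₁ γ act) (hH : H y₁ = ⊥) :
    ∃ β : ((LoopGroup K.Realization (K.pt y₁) →* G) × ∀ y : {y : Y // y ≠ y₁}, G ⧸ H y.1) ≃
        MulAction.orbitRel.Quotient (∀ y : Y, H y)
          (LoopGroup (K.GhostQuotient Y) (K.ghostProj Y (K.pt y₁)) →* G),
      ∀ ψ, β ((K.holonomyData Y y₁ γ ψ).1, fun y => ((K.holonomyData Y y₁ γ ψ).2 y : G ⧸ H y.1)) =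
        Quotient.mk _ ψ := by
  classical
  have h1 : ∀ h : ∀ y : Y, H y, (h y₁ : G) = 1 := fun h => by
    rw [← Subgroup.mem_bot, ← hH]
    exact (h y₁).2
  have hsmul : ∀ (h : ∀ y : Y, H y) ψ, K.holonomyData Y y₁ γ (h • ψ) =
      ((K.holonomyData Y y₁ γ ψ).1, fun y => (K.holonomyData Y y₁ γ ψ).2 y * (h y.1 : G)⁻¹) := by
    intro h ψ
    rw [hact h _ _ ψ rfl, h1]
    refine Prod.ext (MonoidHom.ext fun x => ?_) (funext fun y => ?_)
    · change 1 * (K.holonomyData Y y₁ γ ψ).1 x * 1⁻¹ = _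
      group
    · exact congrArg (· * _) (one_mul _)
  let f : MulAction.orbitRel.Quotient (∀ y : Y, H y)
      (LoopGroup (K.GhostQuotient Y) (K.ghostProj Y (K.pt y₁)) →* G) →
      (LoopGroup K.Realization (K.pt y₁) →* G) × ∀ y : {y : Y // y ≠ y₁}, G ⧸ H y.1 :=
    Quotient.lift (fun ψ => ((K.holonomyData Y y₁ γ ψ).1,
      fun y => ((K.holonomyData Y y₁ γ ψ).2 y : G ⧸ H y.1))) (by
      rintro _ ψ ⟨h, rfl⟩
      refine Prod.ext ?_ (funext fun y => ?_)
      · exact (congrArg Prod.fst (hsmul h ψ) :)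
      · refine (congrArg (fun d => ((d.2 y : G) : G ⧸ H y.1)) (hsmul h ψ)).trans ?_
        exact QuotientGroup.mk_mul_of_mem _ (inv_mem (h y.1).2))
  have hf : Function.Bijective f := by
    constructor
    · rintro ⟨ψ⟩ ⟨ψ'⟩ h
      have h2 : (K.holonomyData Y y₁ γ ψ).1 = (K.holonomyData Y y₁ γ ψ').1 :=
        (congrArg Prod.fst h :)
      have h3 : ∀ y : {y : Y // y ≠ y₁}, ((K.holonomyData Y y₁ γ ψ).2 y)⁻¹ *
          (K.holonomyData Y y₁ γ ψ').2 y ∈ H y.1 := fun y =>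
        QuotientGroup.eq.1 (congrFun (congrArg Prod.snd h :) y)
      -- The element must carry the data `c'` of `ψ'` to the data `c` of `ψ`, that is `c' h⁻¹ = c`,
      -- whence `h = c⁻¹ c'`; at `y₁` only `1` is available.
      refine Quotient.sound ⟨fun y => if hy : y = y₁ then 1 else ⟨_, h3 ⟨y, hy⟩⟩,
        K.holonomyData_injective Y y₁ γ ?_⟩
      refine (hsmul _ _).trans (Prod.ext h2.symm (funext fun y => ?_))
      simp only [dif_neg y.2]
      group
    · rintro ⟨φ, c⟩
      obtain ⟨ψ, hψ⟩ := (K.holonomyData_bijective Y y₁ γ).2 (φ, fun y => (c y).out)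
      refine ⟨Quotient.mk _ ψ, Prod.ext (congrArg Prod.fst hψ :) (funext fun y => ?_)⟩
      change (((K.holonomyData Y y₁ γ ψ).2 y : G) : G ⧸ H y.1) = c y
      rw [hψ]
      exact QuotientGroup.out_eq' _
  refine ⟨(Equiv.ofBijective f hf).symm, fun ψ => ?_⟩
  rw [Equiv.symm_apply_eq]
  rfl

end Action

end TwoComplex

open scoped TensorProduct in
/-- Tensor products of spaces of finitely supported functions. -/
theorem exists_finsupp_tensor_piTensor_equiv (R A : Type*) [CommRing R] {ι : Type*} [Finite ι]
    (κ : ι → Type*) :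
    ∃ e : ((A →₀ R) ⊗[R] (⨂[R] i, (κ i →₀ R))) ≃ₗ[R] (A × (∀ i, κ i) →₀ R),
      ∀ a c, e (Finsupp.single a 1 ⊗ₜ[R] PiTensorProduct.tprod R fun i => Finsupp.single (c i) 1) =
        Finsupp.single (a, c) 1 := by
  classical
  have := Fintype.ofFinite ι
  refine ⟨(TensorProduct.congr (LinearEquiv.refl R _) PiTensorProduct.ofFinsuppEquiv').trans
    (finsuppTensorFinsupp' R A (∀ i, κ i)), fun a c => ?_⟩
  simp

end
-- The main theorem
open scoped TensorProduct in
theorem mainTheorem6 {V E F G : Type*} [Finite V] [Finite E] [Group G] [Finite G]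
    (K : TwoComplex V E F) [ConnectedSpace K.Realization]
    (Y : Set V) (H : Y → Subgroup G) (y₁ : Y)
    (γ : ∀ y : {y : Y // y ≠ y₁}, K.Walk y₁ y.1) :
    Function.Bijective (K.holonomyData (G := G) Y y₁ γ) ∧
    (∀ g : E → G, K.IsFlat g → ∃! ψ, K.IsHolonomy Y y₁ g ψ) ∧
    ∃ act : MulAction (∀ y : Y, H y)
        (LoopGroup (K.GhostQuotient Y) (K.ghostProj Y (K.pt y₁)) →* G),
      (∀ (h : ∀ y : Y, H y) (φ : LoopGroup K.Realization (K.pt y₁) →* G)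
          (c : {y : Y // y ≠ y₁} → G)
          (ψ : LoopGroup (K.GhostQuotient Y) (K.ghostProj Y (K.pt y₁)) →* G),
        K.holonomyData Y y₁ γ ψ = (φ, c) →
        K.holonomyData Y y₁ γ (h • ψ) =
          ((MulAut.conj (h y₁ : G)).toMonoidHom.comp φ,
            fun y => (h y₁ : G) * c y * (h y.1 : G)⁻¹)) ∧
      ∃ Θ : (MulAction.orbitRel.Quotient (∀ y : Y, H y)
          (LoopGroup (K.GhostQuotient Y) (K.ghostProj Y (K.pt y₁)) →* G) →₀ ℂ) ≃ₗ[ℂ]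
          K.quantumDouble Y H,
        (∀ ω, (Θ (Finsupp.single ω 1) : GroupCSS.HilbertSpace E G) =
          GroupCSS.superposition {g | K.IsFlat g ∧
            ∃ ψ, K.IsHolonomy Y y₁ g ψ ∧ Quotient.mk _ ψ = ω}) ∧
        (H y₁ = ⊥ →
          ∃ T : ((LoopGroup K.Realization (K.pt y₁) →* G) →₀ ℂ) ⊗[ℂ]
              (⨂[ℂ] y : {y : Y // y ≠ y₁}, ((G ⧸ H y.1) →₀ ℂ)) ≃ₗ[ℂ] K.quantumDouble Y H,
            ∀ ψ : LoopGroup (K.GhostQuotient Y) (K.ghostProj Y (K.pt y₁)) →* G,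
              T (Finsupp.single (K.holonomyData Y y₁ γ ψ).1 1 ⊗ₜ[ℂ]
                PiTensorProduct.tprod ℂ fun y =>
                  Finsupp.single ((K.holonomyData Y y₁ γ ψ).2 y : G ⧸ H y.1) 1) =
              Θ (Finsupp.single (Quotient.mk _ ψ) 1)) := by
  obtain ⟨act, hact⟩ := K.exists_isDataAction Y H y₁ γ
  refine ⟨K.holonomyData_bijective Y y₁ γ, fun g hg => K.existsUnique_isHolonomy Y y₁ hg,
    act, hact, ?_⟩
  obtain ⟨Θ, hΘ⟩ := hact.exists_equiv
  refine ⟨Θ, hΘ, fun hH => ?_⟩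
  obtain ⟨β, hβ⟩ := hact.exists_orbit_equiv hH
  obtain ⟨e, he⟩ := exists_finsupp_tensor_piTensor_equiv ℂ
    (LoopGroup K.Realization (K.pt y₁) →* G) fun y : {y : Y // y ≠ y₁} => G ⧸ H y.1
  -- Pure tensors of basis vectors become pairs of a homomorphism and a tuple of cosets, these
  -- become orbits by `β`, and `Θ` turns orbits into codewords.
  refine ⟨(e.trans (Finsupp.domLCongr β)).trans Θ, fun ψ => ?_⟩
  rw [LinearEquiv.trans_apply, LinearEquiv.trans_apply, he, Finsupp.domLCongr_single, hβ]
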